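/- Let $M$ be a smooth $d$-dimensional manifold with a Weyl class $[g,a]$, i.e. the set of all pairs $(\mathcal B^{-2}g,\,a-\mathrm d\ln\mathcal B)$, where $g$ is a smooth metric of signature $(p,q)$, $a$ a smooth one-form and $\mathcal B>0$ runs over the smooth positive functions on $M$. Fix any representative $(g,a)$ and use it to identify the bundle $\mathcal P_W\cong\{(x,s^2g_x): x\in M,\ s>0\}$ with $\mathbb R_+\times M$ by $(t,x)\leftrightarrow(x,t^2g_x)$; write $\mathbf g_0=t^2g_{ij}(x)\,\mathrm dx^i\mathrm dx^j$, $\delta_s(t,x,\rho)=(st,x,\rho)$, $\mathcal T=t\partial_t$, and use $0,i,\infty$ for the components along $t,x^i,\rho$. A Weyl-ambient space $(\tilde M,\tilde g)$ for $(M,[g,a])$ is a $\delta_s$-invariant open neighbourhood $\tilde M$ of $\mathcal P_W\times\{0\}$ in $\mathcal P_W\times\mathbb R$ with a smooth metric $\tilde g$ of signature $(p+1,q+1)$ such that $\delta_s^*\tilde g=s^2\tilde g$ for all $s>0$, the pullback of $\tilde g$ to $\mathcal P_W\times\{0\}$ is $\mathbf g_0$, and $\mathrm{Ric}(\tilde g)$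 vanishes to infinite order at every point of $\mathcal P_W\times\{0\}$. It is in Weyl-normal form with acceleration $\mathcal A$ (relative to $(g,a)$) if for each $p\in\mathcal P_W$ the set $\{\rho:(p,\rho)\in\tilde M\}$ is an open interval containing $0$; the tangent field $U=\partial_\rho$ of the lines $\rho\mapsto(p,\rho)$ has acceleration $\mathcal A=\tilde\nabla_UU$ with $\tilde g(\mathcal T,\mathcal A)=0$ and $\tilde g(U,\mathcal A)=0$; and $\tilde g|_{\rho=0}=\mathbf g_0+2t^2(t^{-1}\mathrm dt+a_i(x)\,\mathrm dx^i)\,\mathrm d\rho$. Theorem. Let $(\tilde M,\tilde g)$ be a Weyl-ambient space for $(M,[g,a])$ in Weyl-normal form with acceleration $\mathcal A$. Then $a_i(x,\rho):=a_i(x)+t^{-2}\int_0^\rho\mathcal A_i(t,x,\rho')\,\mathrm d\rho'$ does not depend on $t$, and there is a smooth family $g_{ij}(x,\rho)$ of symmetric tensors on $M$ with $g_{ij}(x,0)=g_{ij}(x)$ such that $$\tilde g=2\rho\,\mathrm dt^2+2t^2\,\mathrm d\rho\Big(\frac{\mathrm dt}{t}+a_i(x,\rho)\,\mathrm dx^i\Big)+t^2g_{ij}(x,\rho)\,\mathrm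 dx^i\,\mathrm dx^j$$ in the following sense. The components $\tilde g_{0\infty}=t$, $\tilde g_{i\infty}=t^2a_i(x,\rho)$, $\tilde g_{\infty\infty}=0$ and $\tilde g_{ij}=t^2g_{ij}(x,\rho)$ are exact on $\tilde M$, and the remaining equations $\tilde g_{00}=2\rho$ and $\tilde g_{0i}=0$ hold to all orders at $\rho=0$ (the difference of the two sides of the displayed formula vanishes to infinite order at every point of $\mathcal P_W\times\{0\}$) if $d$ is odd. If $d$ is even, they hold to order $d/2$ (all derivatives of the difference of order at most $d/2$ vanish there). -/

import Mathlib

open scoped Manifold ContDiff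

noncomputable section

namespace WeylAmbient

/-- The model space of a `d`-dimensional manifold. -/
abbrev Eucl (d : ℕ) : Type := EuclideanSpace ℝ (Fin d)

/-! ### Metrics, one-forms and Weyl classes on a `d`-dimensional manifold `M` -/

/-- The coordinate vector field `∂_i` of the chart around `x₀`, at the point of `M` with
coordinates `y`. -/
def coordVec {d : ℕ} {M : Type*} [TopologicalSpace M] [ChartedSpace (Eucl d) M]
    (x₀ : M) (y : Eucl d) (i : Fin d) :
    TangentSpace (𝓡 d) ((extChartAt (𝓡 d) x₀).symm y) :=
  mfderiv (𝓡 d) (𝓡 d) (extChartAt (𝓡 d) x₀).symm y (EuclideanSpace.single i (1 : ℝ))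

/-- A symmetric bilinear form is nondegenerate of signature `(p, q)`. -/
def HasSignature {V : Type*} [AddCommGroup V] [Module ℝ V]
    (B : LinearMap.BilinForm ℝ V) (p q : ℕ) : Prop :=
  B.IsSymm ∧ B.Nondegenerate ∧ sigPos B.toQuadraticMap = p ∧ sigNeg B.toQuadraticMap = q

/-- A smooth pseudo-Riemannian metric of signature `(p, q)` on `M`. -/
structure PseudoMetric (d : ℕ) (M : Type*) [TopologicalSpace M] [ChartedSpace (Eucl d) M]
    (p q : ℕ) where
  form : ∀ x : M, LinearMap.BilinForm ℝ (TangentSpace (𝓡 d) x)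
  signature : ∀ x : M, HasSignature (form x) p q
  smooth : ∀ (x₀ : M) (i j : Fin d),
    ContDiffOn ℝ ∞ (fun y : Eucl d => form ((extChartAt (𝓡 d) x₀).symm y)
      (coordVec x₀ y i) (coordVec x₀ y j)) (extChartAt (𝓡 d) x₀).target

/-- A smooth one-form `a = a_i dx^i` on `M`. -/
structure OneForm (d : ℕ) (M : Type*) [TopologicalSpace M] [ChartedSpace (Eucl d) M] where
  form : ∀ x : M, TangentSpace (𝓡 d) x →ₗ[ℝ] ℝ
  smooth : ∀ (x₀ : M) (i : Fin d),
    ContDiffOn ℝ ∞ (fun y : Eucl d => form ((extChartAt (𝓡 d) x₀).symm y) (coordVec x₀ y i))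
      (extChartAt (𝓡 d) x₀).target

/-- A pair `(g, a)` of a metric and a Weyl connection one-form. -/
structure WeylPair (d : ℕ) (M : Type*) [TopologicalSpace M] [ChartedSpace (Eucl d) M]
    (p q : ℕ) where
  g : PseudoMetric d M p q
  a : OneForm d M

/-- The differential `d ln B` at `x`. -/
def dLog {d : ℕ} {M : Type*} [TopologicalSpace M] [ChartedSpace (Eucl d) M]
    (B : M → ℝ) (x : M) : TangentSpace (𝓡 d) x →L[ℝ] ℝ :=
  mfderiv (𝓡 d) 𝓘(ℝ, ℝ) (fun x' => Real.log (B x')) x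

/-- `(g', a') = (𝓑⁻² g, a - d ln 𝓑)` for some smooth positive function `𝓑` on `M`. -/
def WeylRelated {d : ℕ} {M : Type*} [TopologicalSpace M] [ChartedSpace (Eucl d) M] {p q : ℕ}
    (r r' : WeylPair d M p q) : Prop :=
  ∃ B : M → ℝ, ContMDiff (𝓡 d) 𝓘(ℝ, ℝ) ∞ B ∧ (∀ x, 0 < B x) ∧
    (∀ (x : M) (v w : TangentSpace (𝓡 d) x),
      r'.g.form x v w = (B x ^ 2)⁻¹ * r.g.form x v w) ∧
    (∀ (x : M) (v : TangentSpace (𝓡 d) x),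
      r'.a.form x v = r.a.form x v - dLog B x v)

/-- A Weyl class `[g, a]`: all pairs related to a given one by a Weyl transformation. -/
def IsWeylClass {d : ℕ} {M : Type*} [TopologicalSpace M] [ChartedSpace (Eucl d) M] {p q : ℕ}
    (C : Set (WeylPair d M p q)) : Prop :=
  ∃ r : WeylPair d M p q, C = {r' | WeylRelated r r'}

/-! ### The space `𝓟_W × ℝ`

The Weyl structure `𝓟_W` is the principal `ℝ₊`-bundle over `M` isomorphic to the metric bundle
`{(x, s² g_x)}`. A representative `g` trivializes it globally, by identifying `(t, x)`, `t > 0`,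
with `(x, t² g_x)`; the dilatations become `δ_s (t, x) = (s t, x)`. A point of `𝓟_W × ℝ` is thus a
triple `(t, x, ρ) : ℝ × M × ℝ` with `0 < t`. -/

/-- The tangent space of `ℝ₊ × M × ℝ` at `(t, x, ρ)`: triples of a `t`-component, a vector tangent
to `M` and a `ρ`-component. -/
abbrev Tan {d : ℕ} {M : Type*} [TopologicalSpace M] [ChartedSpace (Eucl d) M]
    (z : ℝ × M × ℝ) : Type :=
  ℝ × TangentSpace (𝓡 d) z.2.1 × ℝ

/-- A field of bilinear forms on `ℝ₊ × M × ℝ`. -/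
abbrev BilinField (d : ℕ) (M : Type*) [TopologicalSpace M] [ChartedSpace (Eucl d) M] : Type _ :=
  ∀ z : ℝ × M × ℝ, LinearMap.BilinForm ℝ (Tan (d := d) z)

/-- The tautological tensor `𝐠₀ = t² π^* g` of `𝓟_W` at `(t, x)`:
it is `h(π_* w₁, π_* w₂)` with `h = t² g_x`. -/
def tautological {d : ℕ} {M : Type*} [TopologicalSpace M] [ChartedSpace (Eucl d) M] {p q : ℕ}
    (g : PseudoMetric d M p q) (t : ℝ) (x : M) (w₁ w₂ : ℝ × TangentSpace (𝓡 d) x) : ℝ :=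
  (t ^ 2 • g.form x) w₁.2 w₂.2

/-! ### Ambient coordinates `(t, x^i, ρ)` -/

/-- The indices `0, i, ∞` of the ambient coordinates. -/
abbrev Idx (d : ℕ) : Type := Unit ⊕ Fin d ⊕ Unit

/-- The index `∞` of the coordinate `ρ`. -/
abbrev idxInf (d : ℕ) : Idx d := Sum.inr (Sum.inr ())

/-- The space in which the ambient coordinates `(t, x^i, ρ)` take their values. -/
abbrev Coord (d : ℕ) : Type := ℝ × Eucl d × ℝ

/-- The standard basis of the coordinate space. -/
def stdVec {d : ℕ} : Idx d → Coord d
  | Sum.inl _ => (1, 0, 0)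
  | Sum.inr (Sum.inl i) => (0, EuclideanSpace.single i 1, 0)
  | Sum.inr (Sum.inr _) => (0, 0, 1)

/-- The partial derivative `∂_I f`. -/
def pd {d : ℕ} (I : Idx d) (f : Coord d → ℝ) (z : Coord d) : ℝ :=
  fderiv ℝ f z (stdVec I)

/-- The point with ambient coordinates `z`, for the chart of `M` around `x₀`. -/
def ambPoint {d : ℕ} {M : Type*} [TopologicalSpace M] [ChartedSpace (Eucl d) M]
    (x₀ : M) (z : Coord d) : ℝ × M × ℝ :=
  (z.1, (extChartAt (𝓡 d) x₀).symm z.2.1, z.2.2)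

/-- The ambient coordinate vector fields `∂_t, ∂_i, ∂_ρ`. -/
def ambFrame {d : ℕ} {M : Type*} [TopologicalSpace M] [ChartedSpace (Eucl d) M]
    (x₀ : M) (z : Coord d) : Idx d → Tan (d := d) (ambPoint x₀ z)
  | Sum.inl _ => (1, 0, 0)
  | Sum.inr (Sum.inl i) => (0, coordVec x₀ z.2.1 i, 0)
  | Sum.inr (Sum.inr _) => (0, 0, 1)

/-- The components of a field of bilinear forms in ambient coordinates. -/
def comp {d : ℕ} {M : Type*} [TopologicalSpace M] [ChartedSpace (Eucl d) M]
    (x₀ : M) (G : BilinField d M) (I J : Idx d) (z : Coord d) : ℝ :=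
  G (ambPoint x₀ z) (ambFrame x₀ z I) (ambFrame x₀ z J)

/-- The part of the coordinate space that corresponds to the subset `N` of `ℝ₊ × M × ℝ`. -/
def coordDomain {d : ℕ} {M : Type*} [TopologicalSpace M] [ChartedSpace (Eucl d) M]
    (x₀ : M) (N : Set (ℝ × M × ℝ)) : Set (Coord d) :=
  {z | z.2.1 ∈ (extChartAt (𝓡 d) x₀).target ∧ ambPoint x₀ z ∈ N}

/-- The Christoffel symbols `Γ^K_{IJ}` of the Levi-Civita connection of the metric with
components `G`. -/
def christoffel {d : ℕ} (G : Idx d → Idx d → Coord d → ℝ) (K I J : Idx d) (z : Coord d) : ℝ :=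
  (1 / 2) * ∑ L, (Matrix.of fun I' J' => G I' J' z)⁻¹ K L *
    (pd I (G J L) z + pd J (G I L) z - pd L (G I J) z)

/-- The components of the Ricci tensor of the metric with components `G`. -/
def ricci {d : ℕ} (G : Idx d → Idx d → Coord d → ℝ) (I J : Idx d) (z : Coord d) : ℝ :=
  ∑ K, (pd K (christoffel G K I J) z - pd J (christoffel G K I K) z) +
    ∑ K, ∑ L, (christoffel G K K L z * christoffel G L I J z -
      christoffel G K J L z * christoffel G L I K z)

/-- The `K`-th component of the Levi-Civita covariant derivative `∇_X Y`, for vector fields `X`,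
`Y` given by their components. -/
def covDeriv {d : ℕ} (G : Idx d → Idx d → Coord d → ℝ) (X Y : Idx d → Coord d → ℝ)
    (K : Idx d) (z : Coord d) : ℝ :=
  ∑ I, X I z * (pd I (Y K) z + ∑ J, christoffel G K I J z * Y J z)

/-- The components of `∂_ρ`, the tangent vector field of the curves `ρ ↦ (p, ρ)`. -/
def rhoField {d : ℕ} (I : Idx d) (_ : Coord d) : ℝ := if I = idxInf d then 1 else 0

/-- A tensor with components `F x₀ I J` in the ambient coordinates of the chart around `x₀`
vanishes to order `m` at every point of `𝓟_W × {0}`: all partial derivatives of order at most `m`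
of its components are zero there. -/
def VanishesToOrder {d : ℕ} {M : Type*} [TopologicalSpace M] [ChartedSpace (Eucl d) M]
    (F : M → Idx d → Idx d → Coord d → ℝ) (m : ℕ) : Prop :=
  ∀ (x₀ : M) (t : ℝ) (y : Eucl d), 0 < t → y ∈ (extChartAt (𝓡 d) x₀).target →
    ∀ (I J : Idx d) (k : ℕ), k ≤ m → iteratedFDeriv ℝ k (F x₀ I J) (t, y, 0) = 0

/-! ### Weyl-ambient spaces -/

/-- `(N, G)` is a Weyl pre-ambient space for the class of `r = (g, a)`, written in the
trivialization induced by `g`. -/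
structure IsWeylPreAmbient {d : ℕ} {M : Type*} [TopologicalSpace M] [ChartedSpace (Eucl d) M]
    {p q : ℕ} (r : WeylPair d M p q) (N : Set (ℝ × M × ℝ)) (G : BilinField d M) : Prop where
  isOpen : IsOpen N
  pos : ∀ z ∈ N, 0 < z.1
  contains_zero : ∀ (t : ℝ) (x : M), 0 < t → (t, x, 0) ∈ N
  dilatation : ∀ (s t : ℝ) (x : M) (ρ : ℝ), 0 < s → (t, x, ρ) ∈ N → (s * t, x, ρ) ∈ N
  pullback : ∀ (t : ℝ) (x : M), 0 < t → ∀ w₁ w₂ : ℝ × TangentSpace (𝓡 d) x,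
    G (t, x, 0) (w₁.1, w₁.2, 0) (w₂.1, w₂.2, 0) = tautological r.g t x w₁ w₂
  signature : ∀ z ∈ N, HasSignature (G z) (p + 1) (q + 1)
  smooth : ∀ (x₀ : M) (I J : Idx d), ContDiffOn ℝ ∞ (comp x₀ G I J) (coordDomain x₀ N)
  homogeneous : ∀ (s t : ℝ) (x : M) (ρ : ℝ), 0 < s → (t, x, ρ) ∈ N →
    ∀ (τ σ : ℝ) (v w : TangentSpace (𝓡 d) x) (α β : ℝ),
      G (s * t, x, ρ) (s * τ, v, α) (s * σ, w, β) = s ^ 2 * G (t, x, ρ) (τ, v, α) (σ, w, β)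

/-- A Weyl-ambient space: in addition, the Ricci tensor vanishes to infinite order at every point
of `𝓟_W × {0}`. -/
structure IsWeylAmbient {d : ℕ} {M : Type*} [TopologicalSpace M] [ChartedSpace (Eucl d) M]
    {p q : ℕ} (r : WeylPair d M p q) (N : Set (ℝ × M × ℝ)) (G : BilinField d M) : Prop
    extends IsWeylPreAmbient r N G where
  ricciFlat : ∀ m : ℕ, VanishesToOrder (M := M) (fun x₀ => ricci (comp x₀ G)) m

/-- `(N, G)` is in Weyl-normal form with acceleration `A`, relative to `r = (g, a)`. -/
structure IsWeylNormalForm {d : ℕ} {M : Type*} [TopologicalSpace M] [ChartedSpace (Eucl d) M]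
    {p q : ℕ} (r : WeylPair d M p q) (N : Set (ℝ × M × ℝ)) (G : BilinField d M)
    (A : ∀ z : ℝ × M × ℝ, Tan (d := d) z) : Prop where
  /-- Over each point of `𝓟_W`, the values of `ρ` form an open interval containing `0`. -/
  interval : ∀ (t : ℝ) (x : M), 0 < t →
    IsOpen {ρ : ℝ | (t, x, ρ) ∈ N} ∧ {ρ : ℝ | (t, x, ρ) ∈ N}.OrdConnected ∧ (t, x, 0) ∈ N
  /-- `A = ∇_U U`, where `U = ∂_ρ`. -/
  acceleration : ∀ (x₀ : M), ∀ z ∈ coordDomain x₀ N,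
    A (ambPoint x₀ z) = ∑ K, covDeriv (comp x₀ G) rhoField rhoField K z • ambFrame x₀ z K
  /-- `A` is orthogonal to `𝒯 = t ∂_t`. -/
  orthogonal_dilatation : ∀ z ∈ N, G z (z.1, 0, 0) (A z) = 0
  /-- `A` is orthogonal to `U` (this fixes the parametrization of the `ρ`-lines). -/
  orthogonal_tangent : ∀ z ∈ N, G z (0, 0, 1) (A z) = 0
  /-- At `ρ = 0` the metric is `𝐠₀ + 2 t² (t⁻¹ dt + a_i dx^i) dρ`. -/
  initial : ∀ (t : ℝ) (x : M), 0 < t →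
    ∀ (τ σ : ℝ) (v w : TangentSpace (𝓡 d) x) (α β : ℝ),
      G (t, x, 0) (τ, v, α) (σ, w, β) = tautological r.g t x (τ, v) (σ, w)
        + t ^ 2 * ((t⁻¹ * τ + r.a.form x v) * β + (t⁻¹ * σ + r.a.form x w) * α)

/-! ### The Weyl-ambient metric -/

/-- `2 ρ dt² + 2 t² dρ (dt / t + a_i(x, ρ) dx^i) + t² g_ij(x, ρ) dx^i dx^j`, where a product of two
one-forms is the symmetric product `αβ = (α ⊗ β + β ⊗ α) / 2`. -/
def weylAmbientForm {d : ℕ} {M : Type*} [TopologicalSpace M] [ChartedSpace (Eucl d) M]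
    (a : ∀ x : M, ℝ → TangentSpace (𝓡 d) x →ₗ[ℝ] ℝ)
    (g : ∀ x : M, ℝ → LinearMap.BilinForm ℝ (TangentSpace (𝓡 d) x)) : BilinField d M :=
  fun z =>
    let t := z.1
    let ρ := z.2.2
    let dt : Tan (d := d) z →ₗ[ℝ] ℝ := LinearMap.fst ℝ _ _
    let dx : Tan (d := d) z →ₗ[ℝ] TangentSpace (𝓡 d) z.2.1 :=
      LinearMap.fst ℝ _ _ ∘ₗ LinearMap.snd ℝ _ _
    let dρ : Tan (d := d) z →ₗ[ℝ] ℝ := LinearMap.snd ℝ _ _ ∘ₗ LinearMap.snd ℝ _ _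
    let n : Tan (d := d) z →ₗ[ℝ] ℝ := t⁻¹ • dt + a z.2.1 ρ ∘ₗ dx
    (2 * ρ) • LinearMap.BilinForm.linMulLin dt dt
      + t ^ 2 • (LinearMap.BilinForm.linMulLin dρ n + LinearMap.BilinForm.linMulLin n dρ)
      + t ^ 2 • (g z.2.1 ρ).compl₁₂ dx dx

/-- `a_i(x, ρ)` and `g_ij(x, ρ)` are smooth functions of `(x, ρ)` wherever `(t, x, ρ) ∈ N` for some
`t`. -/
def SmoothFamilies {d : ℕ} {M : Type*} [TopologicalSpace M] [ChartedSpace (Eucl d) M]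
    (N : Set (ℝ × M × ℝ)) (a : ∀ x : M, ℝ → TangentSpace (𝓡 d) x →ₗ[ℝ] ℝ)
    (g : ∀ x : M, ℝ → LinearMap.BilinForm ℝ (TangentSpace (𝓡 d) x)) : Prop :=
  ∀ x₀ : M,
    let D : Set (Eucl d × ℝ) := {y | y.1 ∈ (extChartAt (𝓡 d) x₀).target ∧
      ∃ t : ℝ, (t, (extChartAt (𝓡 d) x₀).symm y.1, y.2) ∈ N}
    (∀ i : Fin d, ContDiffOn ℝ ∞
      (fun y : Eucl d × ℝ => a ((extChartAt (𝓡 d) x₀).symm y.1) y.2 (coordVec x₀ y.1 i)) D) ∧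
    (∀ i j : Fin d, ContDiffOn ℝ ∞
      (fun y : Eucl d × ℝ => g ((extChartAt (𝓡 d) x₀).symm y.1) y.2
        (coordVec x₀ y.1 i) (coordVec x₀ y.1 j)) D)

end WeylAmbient

end

open scoped Manifold ContDiff

noncomputable section

namespace WeylAmbient

/-! ### Partial derivatives of smooth functions on an open set -/

section PartialDerivatives

variable {d : ℕ} {Ω : Set (Coord d)} {f g : Coord d → ℝ} {z : Coord d}

/-! Write `U = ∂_ρ` and `T = t ∂_t`. Lowering the index of `∇_U U` gives `∂_ρ G_{∞L} - ½ ∂_L G_{∞∞}`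
(`sum_christoffel_mul`). Orthogonality of the acceleration to `U` makes `G_{∞∞}` constant on the
ρ-lines, hence `0`; then orthogonality to `T` makes `G_{0∞}` constant on them, hence `t`, and
integrating the `i`-components gives `a_i(x, ρ)`. Homogeneity gives `G_{ij} = t² g_ij(x, ρ)`. No
curvature condition enters so far.

The equations for `G_00` and `G_0i` come from Ricci-flatness. Since the dilatations scale `G` by
`s²`, the lowered tensor `F_J^K = ∇_J T^K - δ_J^K` is antisymmetric, half the exterior derivative of
the one-form dual to `T` (`homothetyDefect_eq`). Commuting covariant derivatives yields `T^I R_{IJ}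
= ∇_K F_J^K` (`fst_mul_ricci`).

Put `u = ∂_ρ (G_00 - 2ρ)` and `H_i = F_{i∞} = -½ t ∂_ρ G_{0i}`. If `G_00 - 2ρ` and `G_0i` are
`O(ρ^{n+1})`, then modulo `O(ρ^{n+1})` one finds `t² R_00 ≡ (n - d/2) u` (`van_lapse_succ`), and,
once this has improved `G_00` by one order, `t³ R_0i ≡ (d - 2n) H_i` (`van_shift_succ`). So both
errors gain an order unless `d = 2n`. The induction starts at `n = 0` from the pullback condition;
it never stops for odd `d` and reaches `n = d/2` for even `d`.

Orders are counted by ρ-derivatives alone (`Van`). Derivatives tangent to `ρ = 0` do not lower this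
order, so it also controls all mixed derivatives. -/

theorem differentiableAt_of_smooth (hΩ : IsOpen Ω) (hf : ContDiffOn ℝ ∞ f Ω) (hz : z ∈ Ω) :
    DifferentiableAt ℝ f z :=
  (hf.contDiffAt (hΩ.mem_nhds hz)).differentiableAt (by simp)

theorem smooth_fderiv_apply (hΩ : IsOpen Ω) (hf : ContDiffOn ℝ ∞ f Ω) (v : Coord d) :
    ContDiffOn ℝ ∞ (fun z => fderiv ℝ f z v) Ω :=
  (hf.fderiv_of_isOpen hΩ (by simp)).clm_apply contDiffOn_const

theorem smooth_pd (hΩ : IsOpen Ω) (hf : ContDiffOn ℝ ∞ f Ω) (I : Idx d) :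
    ContDiffOn ℝ ∞ (pd I f) Ω :=
  smooth_fderiv_apply hΩ hf _

theorem pd_congr (hΩ : IsOpen Ω) (h : Set.EqOn f g Ω) (I : Idx d) :
    Set.EqOn (pd I f) (pd I g) Ω := by
  intro z hz
  have : f =ᶠ[nhds z] g := Filter.eventuallyEq_of_mem (hΩ.mem_nhds hz) h
  simp only [pd, this.fderiv_eq]

theorem pd_add (hΩ : IsOpen Ω) (hf : ContDiffOn ℝ ∞ f Ω) (hg : ContDiffOn ℝ ∞ g Ω) (hz : z ∈ Ω)
    (I : Idx d) : pd I (fun z => f z + g z) z = pd I f z + pd I g z := by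
  simp only [pd]
  rw [fderiv_fun_add (differentiableAt_of_smooth hΩ hf hz) (differentiableAt_of_smooth hΩ hg hz)]
  rfl

theorem pd_sub (hΩ : IsOpen Ω) (hf : ContDiffOn ℝ ∞ f Ω) (hg : ContDiffOn ℝ ∞ g Ω) (hz : z ∈ Ω)
    (I : Idx d) : pd I (fun z => f z - g z) z = pd I f z - pd I g z := by
  simp only [pd]
  rw [fderiv_fun_sub (differentiableAt_of_smooth hΩ hf hz) (differentiableAt_of_smooth hΩ hg hz)]
  rfl

theorem pd_mul (hΩ : IsOpen Ω) (hf : ContDiffOn ℝ ∞ f Ω) (hg : ContDiffOn ℝ ∞ g Ω) (hz : z ∈ Ω)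
    (I : Idx d) : pd I (fun z => f z * g z) z = pd I f z * g z + f z * pd I g z := by
  simp only [pd]
  rw [fderiv_fun_mul (differentiableAt_of_smooth hΩ hf hz) (differentiableAt_of_smooth hΩ hg hz)]
  simp only [add_apply, smul_apply, smul_eq_mul]
  ring

theorem pd_const (c : ℝ) (I : Idx d) : pd I (fun _ : Coord d => c) z = 0 := by
  simp [pd]

theorem pd_const_mul (hΩ : IsOpen Ω) (c : ℝ) (hf : ContDiffOn ℝ ∞ f Ω) (hz : z ∈ Ω)
    (I : Idx d) : pd I (fun z => c * f z) z = c * pd I f z := by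
  rw [pd_mul hΩ contDiffOn_const hf hz, pd_const]; ring

theorem pd_fst (I : Idx d) :
    pd I (fun z : Coord d => z.1) z = (stdVec I).1 := by
  simp only [pd]
  rw [fderiv_fst]; rfl

theorem pd_rho (I : Idx d) :
    pd I (fun z : Coord d => z.2.2) z = (stdVec I).2.2 := by
  have : HasFDerivAt (fun z : Coord d => z.2.2)
      ((ContinuousLinearMap.snd ℝ (Eucl d) ℝ).comp (ContinuousLinearMap.snd ℝ ℝ (Eucl d × ℝ))) z :=
    (hasFDerivAt_snd.comp z hasFDerivAt_snd)
  simp only [pd]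
  rw [this.fderiv]; rfl

theorem smooth_fst : ContDiffOn ℝ ∞ (fun z : Coord d => z.1) Ω := contDiffOn_fst

theorem smooth_rho : ContDiffOn ℝ ∞ (fun z : Coord d => z.2.2) Ω :=
  (contDiff_snd.comp contDiff_snd).contDiffOn

theorem pd_comm (hΩ : IsOpen Ω) (hf : ContDiffOn ℝ ∞ f Ω) (hz : z ∈ Ω) (I J : Idx d) :
    pd I (pd J f) z = pd J (pd I f) z := by
  have hs : IsSymmSndFDerivAt ℝ f z :=
    (hf.contDiffAt (hΩ.mem_nhds hz)).isSymmSndFDerivAt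
      (by simpa using (WithTop.coe_le_coe.2 le_top : ((2 : ℕ∞) : WithTop ℕ∞) ≤ ∞))
  have hd : DifferentiableAt ℝ (fderiv ℝ f) z :=
    ((hf.fderiv_of_isOpen hΩ (m := ∞) (by simp)).contDiffAt (hΩ.mem_nhds hz)).differentiableAt
      (by simp)
  have key : ∀ I J : Idx d, pd I (pd J f) z = fderiv ℝ (fderiv ℝ f) z (stdVec I) (stdVec J) := by
    intro I J
    change fderiv ℝ (fun y => fderiv ℝ f y (stdVec J)) z (stdVec I) = _
    rw [fderiv_clm_apply hd (differentiableAt_const _)]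
    simp
  rw [key, key, hs.eq]

theorem coord_eq_sum_stdVec (v : Coord d) :
    v = v.1 • stdVec (Sum.inl ()) + (∑ i, v.2.1 i • stdVec (Sum.inr (Sum.inl i))) +
      v.2.2 • stdVec (idxInf d) := by
  have h : ∑ i, v.2.1 i • (stdVec (Sum.inr (Sum.inl i)) : Coord d) = (0, v.2.1, 0) := by
    refine Prod.ext ?_ (Prod.ext ?_ ?_)
    · simp [Prod.fst_sum, stdVec]
    · ext j
      simp [Prod.fst_sum, Prod.snd_sum, stdVec, Finset.sum_apply, Pi.single_apply]
    · simp [Prod.snd_sum, stdVec]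
  rw [h]
  simp [stdVec]

theorem fderiv_apply_eq_sum_pd (v : Coord d) :
    fderiv ℝ f z v = v.1 * pd (Sum.inl ()) f z + (∑ i, v.2.1 i * pd (Sum.inr (Sum.inl i)) f z) +
      v.2.2 * pd (idxInf d) f z := by
  conv_lhs => rw [coord_eq_sum_stdVec v]
  simp [pd]

/-- The direction differentiated first occupies the last slot. Peeling it off is the induction step
in both passages between `Van` and `iteratedFDeriv`. -/
theorem iteratedFDeriv_fderiv_apply (hΩ : IsOpen Ω) (hf : ContDiffOn ℝ ∞ f Ω) (hz : z ∈ Ω)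
    (k : ℕ) (v : Coord d) (w : Fin k → Coord d) :
    iteratedFDeriv ℝ k (fun y => fderiv ℝ f y v) z w =
      iteratedFDeriv ℝ (k + 1) f z (Fin.snoc w v) := by
  rw [iteratedFDeriv_succ_apply_right]
  have hc : ContDiffAt ℝ ∞ (fun y => fderiv ℝ f y) z :=
    (hf.fderiv_of_isOpen hΩ (m := ∞) (by simp)).contDiffAt (hΩ.mem_nhds hz)
  have := (ContinuousLinearMap.apply ℝ ℝ v).iteratedFDeriv_comp_left hc (i := k)
    (by exact_mod_cast le_top)
  have h2 := congrArg (fun m => m w) this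
  simpa [Function.comp_def] using h2

end PartialDerivatives

/-! ### Functions vanishing to finite order at `ρ = 0` -/

/-- `f` is smooth on `Ω`, and `∂_ρ^k f = 0` on `Ω ∩ {ρ = 0}` for all `k < m`. -/
def Van {d : ℕ} (Ω : Set (Coord d)) : ℕ → (Coord d → ℝ) → Prop
  | 0, f => ContDiffOn ℝ ∞ f Ω
  | m + 1, f => ContDiffOn ℝ ∞ f Ω ∧ (∀ z ∈ Ω, z.2.2 = 0 → f z = 0) ∧ Van Ω m (pd (idxInf d) f)

namespace Van

variable {d : ℕ} {Ω : Set (Coord d)} {f g : Coord d → ℝ} {m n : ℕ}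

theorem smooth : ∀ {m : ℕ}, Van Ω m f → ContDiffOn ℝ ∞ f Ω
  | 0, h => h
  | _ + 1, h => h.1

theorem congr (hΩ : IsOpen Ω) (hf : Van Ω m f) (h : Set.EqOn g f Ω) : Van Ω m g := by
  induction m generalizing f g with
  | zero => exact ContDiffOn.congr hf h
  | succ m ih =>
    exact ⟨hf.1.congr h, fun z hz h0 => (h hz).trans (hf.2.1 z hz h0), ih hf.2.2 (pd_congr hΩ h _)⟩

theorem of_succ (hf : Van Ω (m + 1) f) : Van Ω m f := by
  induction m generalizing f with
  | zero => exact hf.1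
  | succ m ih => exact ⟨hf.1, hf.2.1, ih hf.2.2⟩

theorem mono (hf : Van Ω m f) (h : n ≤ m) : Van Ω n f := by
  induction h with
  | refl => exact hf
  | step _ ih => exact ih (of_succ hf)

theorem add (hΩ : IsOpen Ω) (hf : Van Ω m f) (hg : Van Ω m g) : Van Ω m (fun z => f z + g z) := by
  induction m generalizing f g with
  | zero => exact ContDiffOn.add hf hg
  | succ m ih =>
    refine ⟨hf.1.add hg.1, fun z hz h0 => ?_, (ih hf.2.2 hg.2.2).congr hΩ fun z hz => ?_⟩
    · simp [hf.2.1 z hz h0, hg.2.1 z hz h0]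
    · exact pd_add hΩ hf.1 hg.1 hz _

theorem zero (hΩ : IsOpen Ω) : Van Ω m (fun _ => 0) := by
  induction m with
  | zero => exact contDiffOn_const
  | succ m ih =>
    exact ⟨contDiffOn_const, fun _ _ _ => rfl, ih.congr hΩ fun z _ => pd_const 0 _⟩

theorem sum (hΩ : IsOpen Ω) {ι : Type*} (s : Finset ι) {F : ι → Coord d → ℝ}
    (hF : ∀ i ∈ s, Van Ω m (F i)) : Van Ω m (fun z => ∑ i ∈ s, F i z) := by
  classical
  induction s using Finset.induction_on with
  | empty => simpa using zero hΩ
  | insert i s hi ih =>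
    simp only [Finset.sum_insert hi]
    exact add hΩ (hF i (Finset.mem_insert_self i s))
      (ih fun j hj => hF j (Finset.mem_insert_of_mem hj))

theorem pd_rho (hf : Van Ω (m + 1) f) : Van Ω m (pd (idxInf d) f) := hf.2.2

/-- By the Leibniz rule a ρ-derivative takes one order off one of the factors, so the induction is
on the total order with `m` and `n` free. -/
theorem mul (hΩ : IsOpen Ω) (hf : Van Ω m f) (hg : Van Ω n g) :
    Van Ω (m + n) (fun z => f z * g z) := by
  obtain ⟨k, hk⟩ : ∃ k, m + n = k := ⟨_, rfl⟩
  rw [hk]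
  induction k generalizing m n f g with
  | zero => exact hf.smooth.mul hg.smooth
  | succ k ih =>
    refine ⟨hf.smooth.mul hg.smooth, fun z hz h0 => ?_, ?_⟩
    · rcases m with _ | m
      · rcases n with _ | n
        · omega
        · simp [hg.2.1 z hz h0]
      · simp [hf.2.1 z hz h0]
    · refine congr hΩ (f := fun z => pd (idxInf d) f z * g z + f z * pd (idxInf d) g z) ?_
        fun z hz => pd_mul hΩ hf.smooth hg.smooth hz _
      refine add hΩ ?_ ?_
      -- A factor of order `0` has none to lose; the other factor then carries the whole order `k +
      -- 1` and is weakened to `k`.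
      · rcases m with _ | m
        · exact ih (m := 0) (n := k) (smooth_pd hΩ hf _) (hg.mono (by omega)) (by omega)
        · exact ih hf.2.2 hg (by omega)
      · rcases n with _ | n
        · exact ih (m := k) (n := 0) (hf.mono (by omega)) (smooth_pd hΩ hg _) (by omega)
        · exact ih hf hg.2.2 (by omega)

theorem mul_le (hΩ : IsOpen Ω) {k : ℕ} (hf : Van Ω m f) (hg : Van Ω n g) (hk : k ≤ m + n) :
    Van Ω k (fun z => f z * g z) :=
  (hf.mul hΩ hg).mono hk

theorem mul_smooth (hΩ : IsOpen Ω) (hf : Van Ω m f) (hg : ContDiffOn ℝ ∞ g Ω) :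
    Van Ω m (fun z => f z * g z) :=
  hf.mul hΩ (n := 0) hg

theorem smooth_mul (hΩ : IsOpen Ω) (hf : ContDiffOn ℝ ∞ f Ω) (hg : Van Ω m g) :
    Van Ω m (fun z => f z * g z) :=
  (hg.mul_smooth hΩ hf).congr hΩ fun _ _ => mul_comm _ _

theorem const_mul (hΩ : IsOpen Ω) (c : ℝ) (hg : Van Ω m g) : Van Ω m (fun z => c * g z) :=
  hg.smooth_mul hΩ contDiffOn_const

theorem neg (hΩ : IsOpen Ω) (hf : Van Ω m f) : Van Ω m (fun z => - f z) :=
  (hf.const_mul hΩ (-1)).congr hΩ fun _ _ => (neg_one_mul _).symm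

theorem sub (hΩ : IsOpen Ω) (hf : Van Ω m f) (hg : Van Ω m g) : Van Ω m (fun z => f z - g z) :=
  (hf.add hΩ (hg.neg hΩ)).congr hΩ fun _ _ => sub_eq_add_neg _ _

theorem of_const_mul (hΩ : IsOpen Ω) {c : ℝ} (hc : c ≠ 0) (h : Van Ω m (fun z => c * f z)) :
    Van Ω m f :=
  (h.const_mul hΩ c⁻¹).congr hΩ fun z _ => by field_simp

theorem rho (hΩ : IsOpen Ω) : Van Ω 1 (fun z => z.2.2) :=
  ⟨smooth_rho, fun _ _ h => h, smooth_pd hΩ smooth_rho _⟩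

/-- Euler's identity for the leading coefficient of a function vanishing to order `k`. -/
theorem euler (hΩ : IsOpen Ω) (hf : Van Ω m f) :
    Van Ω (m + 1) (fun z => z.2.2 * pd (idxInf d) f z - m * f z) := by
  induction m generalizing f with
  | zero =>
    refine ((rho hΩ).mul hΩ (n := 0) (smooth_pd hΩ hf (idxInf d))).congr hΩ fun z _ => by simp
  | succ m ih =>
    have hs := hf.1
    have hp := smooth_pd hΩ hs (idxInf d)
    have h1 : ContDiffOn ℝ ∞ (fun z => z.2.2 * pd (idxInf d) f z) Ω := smooth_rho.mul hp
    have h2 : ContDiffOn ℝ ∞ (fun z => ((m + 1 : ℕ) : ℝ) * f z) Ω := contDiffOn_const.mul hs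
    refine ⟨h1.sub h2, fun z hz h0 => by simp [h0, hf.2.1 z hz h0],
      (ih hf.2.2).congr hΩ fun z hz => ?_⟩
    rw [pd_sub hΩ h1 h2 hz, pd_mul hΩ smooth_rho hp hz, pd_const_mul hΩ _ hs hz, WeylAmbient.pd_rho]
    simp only [stdVec]
    push_cast
    ring

theorem of_pd_rho (hf : Van Ω 1 f) (h : Van Ω m (pd (idxInf d) f)) : Van Ω (m + 1) f :=
  ⟨hf.1, hf.2.1, h⟩

/-- Derivatives in directions tangent to `ρ = 0` preserve the order of vanishing. -/
theorem pd_tangential (hΩ : IsOpen Ω) (hf : Van Ω m f) {I : Idx d} (hI : (stdVec I).2.2 = 0) :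
    Van Ω m (pd I f) := by
  induction m generalizing f with
  | zero => exact smooth_pd hΩ hf I
  | succ m ih =>
    refine ⟨smooth_pd hΩ hf.1 I, fun z hz h0 => ?_,
      (ih hf.2.2).congr hΩ fun z hz => pd_comm hΩ hf.1 hz _ _⟩
    have hd := (differentiableAt_of_smooth hΩ hf.1 hz).hasFDerivAt
    have hl : HasDerivAt (fun s : ℝ => f (z + s • stdVec I)) (pd I f z) 0 := by
      have := hd.hasLineDerivAt (stdVec I)
      exact this
    -- The line through `z` in a tangential direction stays in `ρ = 0`, where `f` vanishes.
    have h0' : (fun s : ℝ => f (z + s • stdVec I)) =ᶠ[nhds 0] fun _ => 0 := by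
      have hc : Filter.Tendsto (fun s : ℝ => z + s • stdVec I) (nhds 0) (nhds z) := by
        have : Continuous (fun s : ℝ => z + s • stdVec I) := by fun_prop
        simpa using this.tendsto 0
      filter_upwards [hc (hΩ.mem_nhds hz)] with s hs
      exact hf.2.1 _ hs (by simp [h0, hI])
    exact (hl.congr_of_eventuallyEq h0'.symm).unique (hasDerivAt_const _ _)

theorem pd_any (hΩ : IsOpen Ω) (hf : Van Ω (m + 1) f) (I : Idx d) : Van Ω m (pd I f) := by
  rcases I with _ | i | _
  · exact (hf.pd_tangential hΩ rfl).of_succ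
  · exact (hf.pd_tangential hΩ rfl).of_succ
  · exact hf.2.2

theorem fderiv_apply (hΩ : IsOpen Ω) (hf : Van Ω (m + 1) f) (v : Coord d) :
    Van Ω m (fun z => fderiv ℝ f z v) := by
  refine congr hΩ ?_ (fun z _ => fderiv_apply_eq_sum_pd v)
  refine add hΩ (add hΩ (const_mul hΩ _ (hf.pd_any hΩ _)) ?_) (const_mul hΩ _ (hf.pd_any hΩ _))
  exact sum hΩ _ fun i _ => const_mul hΩ _ (hf.pd_any hΩ _)

/-- Each of the `k` directions costs at most one order, and one order is left to kill the value at
`ρ = 0`. -/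
theorem iteratedFDeriv_eq_zero (hΩ : IsOpen Ω) {k : ℕ} (hf : Van Ω (k + 1) f) {z : Coord d}
    (hz : z ∈ Ω) (h0 : z.2.2 = 0) : iteratedFDeriv ℝ k f z = 0 := by
  induction k generalizing f with
  | zero => ext w; simpa using hf.2.1 z hz h0
  | succ k ih =>
    ext w
    have := iteratedFDeriv_fderiv_apply hΩ hf.1 hz k (w (Fin.last k)) (Fin.init w)
    rw [Fin.snoc_init_self] at this
    rw [← this, ih (hf.fderiv_apply hΩ _)]
    simp

theorem of_iteratedFDeriv (hΩ : IsOpen Ω) (hf : ContDiffOn ℝ ∞ f Ω)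
    (h : ∀ k < m, ∀ z ∈ Ω, z.2.2 = 0 → iteratedFDeriv ℝ k f z = 0) : Van Ω m f := by
  induction m generalizing f with
  | zero => exact hf
  | succ m ih =>
    refine ⟨hf, fun z hz h0 => ?_, ih (smooth_pd hΩ hf _) fun k hk z hz h0 => ?_⟩
    · simpa using congrArg (fun w => w 0) (h 0 (by omega) z hz h0)
    · ext w
      have := iteratedFDeriv_fderiv_apply hΩ hf hz k (stdVec (idxInf d)) w
      rw [h (k + 1) (by omega) z hz h0] at this
      exact this

end Van

/-! ### Metrics with a dilatation symmetry, in coordinates -/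

/-- The index `0` of the coordinate `t`. -/
abbrev idxZero (d : ℕ) : Idx d := Sum.inl ()

/-- The index of the coordinate `x^i`. -/
abbrev idxMid {d : ℕ} (i : Fin d) : Idx d := Sum.inr (Sum.inl i)

/-- The components of the inverse metric. -/
def ginv {d : ℕ} (G : Idx d → Idx d → Coord d → ℝ) (K L : Idx d) (z : Coord d) : ℝ :=
  (Matrix.of fun I J => G I J z)⁻¹ K L

/-- The components of `∂_t`, that is, `1` for the index `0` and `0` otherwise. -/
def wt {d : ℕ} (I : Idx d) : ℝ := (stdVec I).1

@[simp]
theorem wt_inl {d : ℕ} (u : Unit) : wt (Sum.inl u : Idx d) = 1 := rfl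

@[simp]
theorem wt_inr {d : ℕ} (i : Fin d ⊕ Unit) : wt (Sum.inr i : Idx d) = 0 := by
  rcases i with _ | _ <;> rfl

/-- The components `G` of a smooth metric on `Ω` that is homogeneous of degree 2 under dilatations
of `t`, with `G_{∞∞} = 0` and `G_{0∞} = t`. -/
structure IsHomogeneousMetric {d : ℕ} (Ω : Set (Coord d)) (G : Idx d → Idx d → Coord d → ℝ) :
    Prop where
  isOpen : IsOpen Ω
  pos : ∀ z ∈ Ω, 0 < z.1
  smooth : ∀ I J, ContDiffOn ℝ ∞ (G I J) Ω
  symm : ∀ I J, Set.EqOn (G I J) (G J I) Ω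
  det_ne_zero : ∀ z ∈ Ω, (Matrix.of fun I J => G I J z).det ≠ 0
  homogeneous : ∀ I J, ∀ z ∈ Ω, z.1 * pd (idxZero d) (G I J) z = (2 - wt I - wt J) * G I J z
  inf_inf : ∀ z ∈ Ω, G (idxInf d) (idxInf d) z = 0
  zero_inf : ∀ z ∈ Ω, G (idxZero d) (idxInf d) z = z.1

/-- Half the exterior derivative of the one-form dual to `t ∂_t`. -/
def homothetyCurl {d : ℕ} (G : Idx d → Idx d → Coord d → ℝ) (J M : Idx d) (z : Coord d) : ℝ :=
  (1 / 2) * (pd J (fun z => z.1 * G (idxZero d) M z) z - pd M (fun z => z.1 * G (idxZero d) J z) z)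

/-- The tensor `∇_J T^K - δ_J^K` for the vector field `T = t ∂_t`. -/
def homothetyDefect {d : ℕ} (G : Idx d → Idx d → Coord d → ℝ) (J K : Idx d) (z : Coord d) : ℝ :=
  z.1 * christoffel G K (idxZero d) J z + wt J * wt K - (1 : Matrix (Idx d) (Idx d) ℝ) J K

theorem homothetyCurl_antisymm {d : ℕ} (G : Idx d → Idx d → Coord d → ℝ) (J M : Idx d)
    (z : Coord d) :
    homothetyCurl G J M z = - homothetyCurl G M J z := by
  simp only [homothetyCurl]; ring

theorem fst_mul_christoffel {d : ℕ} (G : Idx d → Idx d → Coord d → ℝ) (J K : Idx d) (z : Coord d) :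
    z.1 * christoffel G K (idxZero d) J z =
      homothetyDefect G J K z - wt J * wt K + (1 : Matrix (Idx d) (Idx d) ℝ) J K := by
  simp only [homothetyDefect]; ring

theorem sum_idx {d : ℕ} (f : Idx d → ℝ) :
    ∑ K, f K = f (idxZero d) + ((∑ i, f (idxMid i)) + f (idxInf d)) := by
  simp [Fintype.sum_sum_type]

theorem sum_wt_mul {d : ℕ} (f : Idx d → ℝ) : ∑ K, wt K * f K = f (idxZero d) := by
  simp

theorem sum_one_mul {d : ℕ} (J : Idx d) (f : Idx d → ℝ) :
    ∑ K, (1 : Matrix (Idx d) (Idx d) ℝ) J K * f K = f J := by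
  simp [Matrix.one_apply]

theorem smooth_det {d : ℕ} {ι : Type*} [Fintype ι] [DecidableEq ι] {Ω : Set (Coord d)}
    {A : ι → ι → Coord d → ℝ} (hA : ∀ i j, ContDiffOn ℝ ∞ (A i j) Ω) :
    ContDiffOn ℝ ∞ (fun z => (Matrix.of fun i j => A i j z).det) Ω := by
  simp only [Matrix.det_apply', Matrix.of_apply]
  exact ContDiffOn.sum fun σ _ => contDiffOn_const.mul (contDiffOn_prod fun i _ => hA _ _)

/-! ### The dilatation field as a homothety, and its contraction with the Ricci tensor -/

namespace IsHomogeneousMetric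

variable {d : ℕ} {Ω : Set (Coord d)} {G : Idx d → Idx d → Coord d → ℝ}

/-- Cramer's rule: adjugate entries are determinants of the matrix with one row made constant. -/
theorem smooth_ginv (h : IsHomogeneousMetric Ω G)
    (K L : Idx d) : ContDiffOn ℝ ∞ (ginv G K L) Ω := by
  have hadj : ContDiffOn ℝ ∞ (fun z => (Matrix.of fun I J => G I J z).adjugate K L) Ω := by
    simp only [Matrix.adjugate_apply]
    have := smooth_det (Ω := Ω)
      (A := fun I J z => (Matrix.of fun I J => G I J z).updateRow L (Pi.single K 1) I J) ?_
    · exact this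
    · intro I J
      by_cases hI : I = L
      · subst hI
        simpa using contDiffOn_const
      · simpa [Matrix.updateRow_apply, hI] using h.smooth I J
  refine (((smooth_det h.smooth).inv h.det_ne_zero).mul hadj).congr fun z hz => ?_
  simp only [ginv, Matrix.inv_def, Ring.inverse_eq_inv', Matrix.smul_apply, smul_eq_mul,
    Pi.inv_apply]

theorem smooth_christoffel (h : IsHomogeneousMetric Ω G)
    (K I J : Idx d) : ContDiffOn ℝ ∞ (christoffel G K I J) Ω := by
  have hp : ∀ I J L, ContDiffOn ℝ ∞ (pd I (G J L)) Ω := fun I J L =>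
    smooth_pd h.isOpen (h.smooth J L) I
  exact contDiffOn_const.mul (ContDiffOn.sum fun L _ =>
    (h.smooth_ginv K L).mul (((hp _ _ _).add (hp _ _ _)).sub (hp _ _ _)))

theorem smooth_inv_fst (h : IsHomogeneousMetric Ω G) :
    ContDiffOn ℝ ∞ (fun z : Coord d => z.1⁻¹) Ω :=
  smooth_fst.inv fun z hz => (h.pos z hz).ne'

theorem christoffel_symm (h : IsHomogeneousMetric Ω G) (K I J : Idx d) :
    Set.EqOn (christoffel G K I J) (christoffel G K J I) Ω := by
  intro z hz
  simp only [christoffel]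
  congr 1
  refine Finset.sum_congr rfl fun L _ => ?_
  rw [pd_congr h.isOpen (h.symm I J) L hz]
  ring

theorem sum_ginv_mul (h : IsHomogeneousMetric Ω G) (K J : Idx d) {z : Coord d} (hz : z ∈ Ω) :
    ∑ M, ginv G K M z * G M J z = (1 : Matrix (Idx d) (Idx d) ℝ) K J := by
  have := Matrix.nonsing_inv_mul (Matrix.of fun I J => G I J z)
    (isUnit_iff_ne_zero.2 (h.det_ne_zero z hz))
  simpa [Matrix.mul_apply, ginv] using congrFun (congrFun this K) J

theorem ginv_symm (h : IsHomogeneousMetric Ω G)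
    (K J : Idx d) : Set.EqOn (ginv G K J) (ginv G J K) Ω := by
  intro z hz
  have hT : (Matrix.of fun I J => G I J z).transpose = Matrix.of fun I J => G I J z := by
    ext I J
    exact h.symm J I hz
  have := Matrix.transpose_nonsing_inv (Matrix.of fun I J => G I J z)
  rw [hT] at this
  exact congrFun (congrFun this J) K

theorem smooth_homothetyDefect (h : IsHomogeneousMetric Ω G)
    (J K : Idx d) : ContDiffOn ℝ ∞ (homothetyDefect G J K) Ω :=
  ((smooth_fst.mul (h.smooth_christoffel _ _ _)).add contDiffOn_const).sub contDiffOn_const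

theorem homothetyCurl_eq (h : IsHomogeneousMetric Ω G) (J M : Idx d) {z : Coord d} (hz : z ∈ Ω) :
    homothetyCurl G J M z = (1 / 2) * (wt J * G (idxZero d) M z + z.1 * pd J (G (idxZero d) M) z
      - wt M * G (idxZero d) J z - z.1 * pd M (G (idxZero d) J) z) := by
  simp only [homothetyCurl, pd_mul h.isOpen smooth_fst (h.smooth _ _) hz, pd_fst, wt]
  ring

/-- Homogeneity says that the symmetric part of the lowered `∇T` is the metric itself, which cancels
against `δ`; the antisymmetric part remains. -/
theorem homothetyDefect_eq (h : IsHomogeneousMetric Ω G) (J K : Idx d) {z : Coord d} (hz : z ∈ Ω) :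
    homothetyDefect G J K z = ∑ M, ginv G K M z * homothetyCurl G J M z := by
  have key : ∀ M, homothetyCurl G J M z = (1 / 2) * z.1 * (pd (idxZero d) (G J M) z
      + pd J (G (idxZero d) M) z - pd M (G (idxZero d) J) z) + wt J * G M (idxZero d) z
      - G M J z := by
    intro M
    rw [h.homothetyCurl_eq J M hz, h.symm M J hz, h.symm M _ hz]
    have hh := h.homogeneous J M z hz
    -- Weights are `0` except at the index `0`, where the bracket vanishes. This and `h2` trade the
    -- weights in the homogeneity relation for components of `T`.
    have h1 : wt J * (G J M z - G (idxZero d) M z) = 0 := by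
      rcases J with _ | j | _ <;> simp
    have h2 : wt M * (G J M z - G (idxZero d) J z) = 0 := by
      rcases M with _ | j | _
      · simp [h.symm J (Sum.inl _) hz]
      all_goals simp
    linear_combination (-1/2) * hh + (1/2) * h1 + (1/2) * h2
  simp only [key, mul_sub, mul_add, Finset.sum_sub_distrib, Finset.sum_add_distrib]
  rw [h.sum_ginv_mul K J hz]
  have h0 : ∑ M, ginv G K M z * (wt J * G M (idxZero d) z) = wt J * wt K := by
    have := h.sum_ginv_mul K (idxZero d) hz
    calc _ = wt J * ∑ M, ginv G K M z * G M (idxZero d) z := by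
          rw [Finset.mul_sum]; exact Finset.sum_congr rfl fun _ _ => by ring
      _ = _ := by
          rw [this]
          rcases K with _ | j | _ <;> simp
  rw [h0, homothetyDefect, christoffel]
  have : (1 : Matrix (Idx d) (Idx d) ℝ) J K = (1 : Matrix (Idx d) (Idx d) ℝ) K J := by
    simp [Matrix.one_apply, eq_comm]
  rw [this]
  simp only [← Finset.sum_add_distrib, ← Finset.sum_sub_distrib, Finset.mul_sum]
  congr 2
  refine Finset.sum_congr rfl fun M _ => ?_
  simp only [ginv]
  ring

/-- A symmetric inverse metric is contracted with an antisymmetric tensor. -/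
theorem homothetyDefect_trace (h : IsHomogeneousMetric Ω G)
    {z : Coord d} (hz : z ∈ Ω) : ∑ K, homothetyDefect G K K z = 0 := by
  have h1 : ∑ K, homothetyDefect G K K z = ∑ K, ∑ M, ginv G K M z * homothetyCurl G K M z :=
    Finset.sum_congr rfl fun K _ => h.homothetyDefect_eq K K hz
  have h2 : ∑ K, ∑ M, ginv G K M z * homothetyCurl G K M z =
      - ∑ K, ∑ M, ginv G K M z * homothetyCurl G K M z := by
    conv_lhs => rw [Finset.sum_comm]
    simp only [← Finset.sum_neg_distrib]
    refine Finset.sum_congr rfl fun K _ => Finset.sum_congr rfl fun M _ => ?_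
    rw [homothetyCurl_antisymm G M K, h.ginv_symm M K hz]
    ring
  linarith

/-- The divergence of `T` is `d + 2`, of which `∂_t t` contributes `1`. -/
theorem fst_mul_christoffel_trace (h : IsHomogeneousMetric Ω G) {z : Coord d} (hz : z ∈ Ω) :
    z.1 * ∑ K, christoffel G K K (idxZero d) z = d + 1 := by
  have h1 : z.1 * ∑ K, christoffel G K K (idxZero d) z = ∑ K, (homothetyDefect G K K z
      - wt K * wt K + 1) := by
    rw [Finset.mul_sum]
    refine Finset.sum_congr rfl fun K _ => ?_
    rw [h.christoffel_symm K K _ hz, fst_mul_christoffel]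
    simp
  rw [h1, Finset.sum_add_distrib, Finset.sum_sub_distrib, h.homothetyDefect_trace hz, sum_wt_mul]
  simp

theorem pd_homothetyDefect (h : IsHomogeneousMetric Ω G)
    (I J K : Idx d) {z : Coord d} (hz : z ∈ Ω) :
    pd I (homothetyDefect G J K) z = wt I * christoffel G K (idxZero d) J z
      + z.1 * pd I (christoffel G K (idxZero d) J) z := by
  have hc := h.smooth_christoffel K (idxZero d) J
  have h1 : ContDiffOn ℝ ∞ (fun z => z.1 * christoffel G K (idxZero d) J z) Ω := smooth_fst.mul hc
  have : homothetyDefect G J K = fun z => (z.1 * christoffel G K (idxZero d) J z + wt J * wt K)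
      - (1 : Matrix (Idx d) (Idx d) ℝ) J K := rfl
  rw [this, pd_sub h.isOpen (h1.add contDiffOn_const) contDiffOn_const hz,
    pd_add h.isOpen h1 contDiffOn_const hz, pd_mul h.isOpen smooth_fst hc hz, pd_fst, pd_const,
    pd_const, wt]
  ring

/-- The contraction of the Ricci tensor with `t ∂_t` is a divergence. -/
theorem fst_mul_ricci (h : IsHomogeneousMetric Ω G) (J : Idx d) {z : Coord d} (hz : z ∈ Ω) :
    z.1 * ricci G (idxZero d) J z = ∑ K, pd K (homothetyDefect G J K) z
      + (∑ L, (∑ K, christoffel G K K L z) * homothetyDefect G J L z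
        - ∑ K, ∑ L, christoffel G K J L z * homothetyDefect G K L z) := by
  -- The trace vanishes identically on the open set, so the `∇_J ∇_K T^K` half of the commutator
  -- drops out.
  have htr : ∑ K, pd J (homothetyDefect G K K) z = 0 := by
    have h1 : pd J (fun z => ∑ K, homothetyDefect G K K z) z = 0 := by
      rw [pd_congr h.isOpen (fun z hz => h.homothetyDefect_trace hz) J hz, pd_const]
    rw [← h1]
    simp only [pd]
    rw [fderiv_fun_sum fun K _ => differentiableAt_of_smooth h.isOpen
      (h.smooth_homothetyDefect K K) hz]
    simp
  -- In `hA`, `hB`, `hC` each `t Γ^L_{0J}` is replaced by `F_J^L - δ_J^0 δ_0^L + δ_J^L`. The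
  -- leftover Christoffel terms cancel in `hA + hB - hC` by symmetry of the lower indices.
  have hA : z.1 * ∑ K, (pd K (christoffel G K (idxZero d) J) z
      - pd J (christoffel G K (idxZero d) K) z) = ∑ K, pd K (homothetyDefect G J K) z
      - christoffel G (idxZero d) (idxZero d) J z
      + wt J * ∑ K, christoffel G K (idxZero d) K z := by
    have h1 : ∑ K, pd K (homothetyDefect G J K) z =
        christoffel G (idxZero d) (idxZero d) J z
          + z.1 * ∑ K, pd K (christoffel G K (idxZero d) J) z := by
      simp only [h.pd_homothetyDefect _ _ _ hz, Finset.sum_add_distrib, Finset.mul_sum]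
      rw [sum_wt_mul (fun K => christoffel G K (idxZero d) J z)]
    simp only [h.pd_homothetyDefect _ _ _ hz, Finset.sum_add_distrib, ← Finset.mul_sum] at htr
    rw [h1, Finset.sum_sub_distrib]
    linear_combination -htr
  have hB : z.1 * ∑ K, ∑ L, christoffel G K K L z * christoffel G L (idxZero d) J z
      = ∑ L, (∑ K, christoffel G K K L z) * homothetyDefect G J L z
        - wt J * (∑ K, christoffel G K K (idxZero d) z) + ∑ K, christoffel G K K J z := by
    have e : z.1 * ∑ K, ∑ L, christoffel G K K L z * christoffel G L (idxZero d) J z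
      = ∑ L, ((∑ K, christoffel G K K L z) * homothetyDefect G J L z
        - wt J * (wt L * (∑ K, christoffel G K K L z))
        + (1 : Matrix (Idx d) (Idx d) ℝ) J L * ∑ K, christoffel G K K L z) := by
      rw [Finset.sum_comm, Finset.mul_sum]
      refine Finset.sum_congr rfl fun L _ => ?_
      rw [← Finset.sum_mul]
      linear_combination (∑ K, christoffel G K K L z) * fst_mul_christoffel G J L z
    rw [e, Finset.sum_add_distrib, Finset.sum_sub_distrib, sum_one_mul, ← Finset.mul_sum,
      sum_wt_mul (fun L => ∑ K, christoffel G K K L z)]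
  have hC : z.1 * ∑ K, ∑ L, christoffel G K J L z * christoffel G L (idxZero d) K z
      = ∑ K, ∑ L, christoffel G K J L z * homothetyDefect G K L z
        - christoffel G (idxZero d) J (idxZero d) z + ∑ K, christoffel G K J K z := by
    have e : ∀ K, z.1 * ∑ L, christoffel G K J L z * christoffel G L (idxZero d) K z
        = ∑ L, christoffel G K J L z * homothetyDefect G K L z
          - wt K * christoffel G K J (idxZero d) z + christoffel G K J K z := by
      intro K
      have e' : z.1 * ∑ L, christoffel G K J L z * christoffel G L (idxZero d) K z
        = ∑ L, (christoffel G K J L z * homothetyDefect G K L z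
          - wt K * (wt L * christoffel G K J L z)
          + (1 : Matrix (Idx d) (Idx d) ℝ) K L * christoffel G K J L z) := by
        rw [Finset.mul_sum]
        refine Finset.sum_congr rfl fun L _ => ?_
        linear_combination (christoffel G K J L z) * fst_mul_christoffel G K L z
      rw [e', Finset.sum_add_distrib, Finset.sum_sub_distrib, sum_one_mul, ← Finset.mul_sum,
        sum_wt_mul (fun L => christoffel G K J L z)]
    rw [Finset.mul_sum, Finset.sum_congr rfl fun K _ => e K, Finset.sum_add_distrib,
      Finset.sum_sub_distrib, sum_wt_mul (fun K => christoffel G K J (idxZero d) z)]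
  have s1 : ∑ K, christoffel G K (idxZero d) K z = ∑ K, christoffel G K K (idxZero d) z :=
    Finset.sum_congr rfl fun K _ => h.christoffel_symm K _ _ hz
  have s2 : ∑ K, christoffel G K J K z = ∑ K, christoffel G K K J z :=
    Finset.sum_congr rfl fun K _ => h.christoffel_symm K _ _ hz
  have s3 := h.christoffel_symm (idxZero d) (idxZero d) J hz
  simp only [ricci, Finset.sum_sub_distrib (f := fun K => ∑ L, _), Finset.sum_sub_distrib,
    mul_add, mul_sub] at hA hB hC ⊢
  rw [s1] at hA
  rw [s2] at hC
  linear_combination hA + hB - hC - s3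

end IsHomogeneousMetric

theorem homothetyCurl_self {d : ℕ} (G : Idx d → Idx d → Coord d → ℝ) (J : Idx d) (z : Coord d) :
    homothetyCurl G J J z = 0 := by
  simp [homothetyCurl]

/-- The difference of `G_00` and `2 ρ`. -/
def lapse {d : ℕ} (G : Idx d → Idx d → Coord d → ℝ) (z : Coord d) : ℝ :=
  G (idxZero d) (idxZero d) z - 2 * z.2.2

namespace IsHomogeneousMetric

variable {d : ℕ} {Ω : Set (Coord d)} {G : Idx d → Idx d → Coord d → ℝ}

/-! ### Curl and inverse metric in terms of the errors in `G_00` and `G_0i` -/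

section Components

theorem smooth_lapse (h : IsHomogeneousMetric Ω G) : ContDiffOn ℝ ∞ (lapse G) Ω :=
  (h.smooth _ _).sub (contDiffOn_const.mul smooth_rho)

theorem pd_lapse (h : IsHomogeneousMetric Ω G) (I : Idx d) {z : Coord d} (hz : z ∈ Ω) :
    pd I (lapse G) z = pd I (G (idxZero d) (idxZero d)) z - 2 * (stdVec I).2.2 := by
  have : lapse G = fun z => G (idxZero d) (idxZero d) z - 2 * z.2.2 := rfl
  rw [this, pd_sub h.isOpen (h.smooth _ _) (contDiffOn_const.mul smooth_rho) hz,
    pd_const_mul h.isOpen _ smooth_rho hz, pd_rho]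

/-- With `G_{0∞} = t`, the derivative of `t G_{0∞}` is `2t`, exactly cancelled by the derivative of
`2ρ` in `G_00`: this singles out `2ρ` as the reference value. -/
theorem homothetyCurl_zero_inf (h : IsHomogeneousMetric Ω G) {z : Coord d} (hz : z ∈ Ω) :
    homothetyCurl G (idxZero d) (idxInf d) z = -(1 / 2) * (z.1 * pd (idxInf d) (lapse G) z) := by
  have h1 : Set.EqOn (G (idxZero d) (idxInf d)) (fun z => z.1) Ω := h.zero_inf
  rw [h.homothetyCurl_eq _ _ hz, pd_congr h.isOpen h1 _ hz, h.pd_lapse _ hz, h.zero_inf z hz,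
    pd_fst]
  simp [stdVec]
  ring

theorem homothetyCurl_mid_inf (h : IsHomogeneousMetric Ω G) (i : Fin d) {z : Coord d} (hz : z ∈ Ω) :
    homothetyCurl G (idxMid i) (idxInf d) z =
      -(1 / 2) * (z.1 * pd (idxInf d) (G (idxZero d) (idxMid i)) z) := by
  have h1 : Set.EqOn (G (idxZero d) (idxInf d)) (fun z => z.1) Ω := h.zero_inf
  rw [h.homothetyCurl_eq _ _ hz, pd_congr h.isOpen h1 _ hz, pd_fst]
  simp [stdVec]

theorem homothetyCurl_mid_zero (h : IsHomogeneousMetric Ω G)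
    (i : Fin d) {z : Coord d} (hz : z ∈ Ω) :
    homothetyCurl G (idxMid i) (idxZero d) z =
      (1 / 2) * (z.1 * pd (idxMid i) (lapse G) z) - G (idxZero d) (idxMid i) z := by
  have := h.homogeneous (idxZero d) (idxMid i) z hz
  rw [h.homothetyCurl_eq _ _ hz, this, h.pd_lapse _ hz]
  simp [stdVec]
  ring

theorem homothetyCurl_mid_mid (h : IsHomogeneousMetric Ω G)
    (i j : Fin d) {z : Coord d} (hz : z ∈ Ω) :
    homothetyCurl G (idxMid i) (idxMid j) z = (1 / 2) * (z.1 *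
      (pd (idxMid i) (G (idxZero d) (idxMid j)) z
        - pd (idxMid j) (G (idxZero d) (idxMid i)) z)) := by
  rw [h.homothetyCurl_eq _ _ hz]
  simp
  ring

/-- The equation `G^{KM} G_{M0} = δ^K_0`, solved for `G^{K∞}`. -/
theorem ginv_inf_eq (h : IsHomogeneousMetric Ω G) (K : Idx d) {z : Coord d} (hz : z ∈ Ω) :
    ginv G K (idxInf d) z = z.1⁻¹ * (wt K - ginv G K (idxZero d) z * (2 * z.2.2 + lapse G z)
      - ∑ i, ginv G K (idxMid i) z * G (idxZero d) (idxMid i) z) := by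
  have h1 := h.sum_ginv_mul K (idxZero d) hz
  have hw : (1 : Matrix (Idx d) (Idx d) ℝ) K (idxZero d) = wt K := by
    rcases K with _ | _ <;> simp
  rw [sum_idx, hw, h.symm (idxInf d) _ hz, h.zero_inf z hz] at h1
  have h2 : ∑ i, ginv G K (idxMid i) z * G (idxMid i) (idxZero d) z =
      ∑ i, ginv G K (idxMid i) z * G (idxZero d) (idxMid i) z :=
    Finset.sum_congr rfl fun i _ => by rw [h.symm (idxMid i) _ hz]
  rw [h2] at h1
  have ht := (h.pos z hz).ne'
  rw [lapse]
  field_simp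
  linear_combination h1

theorem pd_zero_lapse (h : IsHomogeneousMetric Ω G)
    {z : Coord d} (hz : z ∈ Ω) : pd (idxZero d) (lapse G) z = 0 := by
  have h1 := h.homogeneous (idxZero d) (idxZero d) z hz
  have ht := (h.pos z hz).ne'
  have h2 : z.1 * pd (idxZero d) (G (idxZero d) (idxZero d)) z = 0 := by
    rw [h1]
    simp
    norm_num
  rw [h.pd_lapse _ hz, (mul_eq_zero.1 h2).resolve_left ht]
  simp [stdVec]

end Components

/-- The metric agrees with `2 ρ dt² + …` in the components `00` and `0i` to order `n`. -/
structure AgreesToOrder (Ω : Set (Coord d)) (G : Idx d → Idx d → Coord d → ℝ) (n : ℕ) : Prop where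
  lapse : Van Ω (n + 1) (lapse G)
  shift : ∀ i, Van Ω (n + 1) (G (idxZero d) (idxMid i))

/-! ### Orders of vanishing of the inverse metric, the curl and the defect -/

section Order

variable {n : ℕ}

theorem van_two_rho_add_lapse (h : IsHomogeneousMetric Ω G) (hD : AgreesToOrder Ω G n) :
    Van Ω 1 (fun z => 2 * z.2.2 + lapse G z) :=
  ((Van.rho h.isOpen).const_mul h.isOpen 2).add h.isOpen (hD.lapse.mono (by omega))

theorem van_sum_ginv_shift (h : IsHomogeneousMetric Ω G) (hD : AgreesToOrder Ω G n) (K : Idx d) :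
    Van Ω (n + 1) (fun z => ∑ i, ginv G K (idxMid i) z * G (idxZero d) (idxMid i) z) :=
  Van.sum h.isOpen _ fun i _ => (hD.shift i).smooth_mul h.isOpen (h.smooth_ginv _ _)

/-- At `ρ = 0` the only nonzero `G_{M0}` is `G_{∞0} = t`, which determines `G^{K∞}` there. -/
theorem van_ginv_inf_sub (h : IsHomogeneousMetric Ω G) (hD : AgreesToOrder Ω G n) (K : Idx d) :
    Van Ω 1 (fun z => ginv G K (idxInf d) z - wt K * z.1⁻¹) := by
  have h1 := (h.van_two_rho_add_lapse hD).smooth_mul h.isOpen (h.smooth_ginv K (idxZero d))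
  have h2 := (h.van_sum_ginv_shift hD K).mono (n := 1) (by omega)
  refine ((h1.add h.isOpen h2).smooth_mul h.isOpen h.smooth_inv_fst.neg).congr h.isOpen
    fun z hz => ?_
  simp only [h.ginv_inf_eq K hz]
  ring

theorem van_ginv_inr_inf (h : IsHomogeneousMetric Ω G) (hD : AgreesToOrder Ω G n)
    (i : Fin d ⊕ Unit) : Van Ω 1 (ginv G (Sum.inr i) (idxInf d)) :=
  (h.van_ginv_inf_sub hD (Sum.inr i)).congr h.isOpen fun z _ => by simp

theorem van_ginv_inf_mid (h : IsHomogeneousMetric Ω G) (hD : AgreesToOrder Ω G n)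
    (i : Fin d) : Van Ω 1 (ginv G (idxInf d) (idxMid i)) :=
  (h.van_ginv_inr_inf hD _).congr h.isOpen (h.ginv_symm _ _)

theorem van_ginv_zero_inf_sub (h : IsHomogeneousMetric Ω G) (hD : AgreesToOrder Ω G n) :
    Van Ω 1 (fun z => ginv G (idxZero d) (idxInf d) z - z.1⁻¹) :=
  (h.van_ginv_inf_sub hD (idxZero d)).congr h.isOpen fun z _ => by simp

theorem van_ginv_inf_zero_sub (h : IsHomogeneousMetric Ω G) (hD : AgreesToOrder Ω G n) :
    Van Ω 1 (fun z => ginv G (idxInf d) (idxZero d) z - z.1⁻¹) :=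
  (h.van_ginv_zero_inf_sub hD).congr h.isOpen fun z hz =>
    congrArg (· - z.1⁻¹) (h.ginv_symm (idxInf d) (idxZero d) hz)

/-- Second order is needed because `G^{∞∞}` multiplies curl components of order only `n` in
expressions required to order `n + 2`, before a ρ-derivative is taken. -/
theorem van_ginv_inf_inf_add (h : IsHomogeneousMetric Ω G) (hD : AgreesToOrder Ω G n) :
    Van Ω 2 (fun z => ginv G (idxInf d) (idxInf d) z
    + (z.1⁻¹ * z.1⁻¹) * (2 * z.2.2 + lapse G z)) := by
  have h1 := (h.van_ginv_inf_zero_sub hD).mul h.isOpen (h.van_two_rho_add_lapse hD)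
  have h2 : Van Ω 2 (fun z => ∑ i, ginv G (idxInf d) (idxMid i) z * G (idxZero d) (idxMid i) z) :=
    Van.sum h.isOpen _ fun i _ => (h.van_ginv_inf_mid hD i).mul_le h.isOpen (hD.shift i) (by omega)
  refine ((h1.add h.isOpen h2).smooth_mul h.isOpen h.smooth_inv_fst.neg).congr h.isOpen
    fun z hz => ?_
  simp only [h.ginv_inf_eq (idxInf d) hz, wt_inr]
  ring

/-- Curl components without the index `∞` contain no ρ-derivative of the errors and lose no order;
those with exactly one `∞` lose one. -/
theorem van_curl_mid_zero (h : IsHomogeneousMetric Ω G) (hD : AgreesToOrder Ω G n) (i : Fin d) :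
    Van Ω (n + 1) (homothetyCurl G (idxMid i) (idxZero d)) :=
  ((((hD.lapse.pd_tangential h.isOpen (I := idxMid i) rfl).smooth_mul h.isOpen
    smooth_fst).const_mul h.isOpen (1 / 2)).sub h.isOpen (hD.shift i)).congr h.isOpen
    fun _ hz => h.homothetyCurl_mid_zero i hz

theorem van_curl_zero_mid (h : IsHomogeneousMetric Ω G) (hD : AgreesToOrder Ω G n) (i : Fin d) :
    Van Ω (n + 1) (homothetyCurl G (idxZero d) (idxMid i)) :=
  ((h.van_curl_mid_zero hD i).neg h.isOpen).congr h.isOpen fun z _ => homothetyCurl_antisymm G _ _ z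

theorem van_curl_mid_mid (h : IsHomogeneousMetric Ω G) (hD : AgreesToOrder Ω G n) (i j : Fin d) :
    Van Ω (n + 1) (homothetyCurl G (idxMid i) (idxMid j)) :=
  (((((hD.shift j).pd_tangential h.isOpen (I := idxMid i) rfl).sub h.isOpen
    ((hD.shift i).pd_tangential h.isOpen (I := idxMid j) rfl)).smooth_mul h.isOpen
    smooth_fst).const_mul h.isOpen (1 / 2)).congr h.isOpen
    fun _ hz => h.homothetyCurl_mid_mid i j hz

theorem van_curl_zero_inf (h : IsHomogeneousMetric Ω G) (hD : AgreesToOrder Ω G n) :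
    Van Ω n (homothetyCurl G (idxZero d) (idxInf d)) :=
  ((hD.lapse.pd_rho.smooth_mul h.isOpen smooth_fst).const_mul h.isOpen _).congr h.isOpen
    fun _ hz => h.homothetyCurl_zero_inf hz

theorem van_curl_inf_zero (h : IsHomogeneousMetric Ω G) (hD : AgreesToOrder Ω G n) :
    Van Ω n (homothetyCurl G (idxInf d) (idxZero d)) :=
  ((h.van_curl_zero_inf hD).neg h.isOpen).congr h.isOpen fun z _ => homothetyCurl_antisymm G _ _ z

theorem van_curl_mid_inf (h : IsHomogeneousMetric Ω G) (hD : AgreesToOrder Ω G n)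
    (i : Fin d) : Van Ω n (homothetyCurl G (idxMid i) (idxInf d)) :=
  (((hD.shift i).pd_rho.smooth_mul h.isOpen smooth_fst).const_mul h.isOpen _).congr h.isOpen
    fun _ hz => h.homothetyCurl_mid_inf i hz

theorem van_curl_inf_mid (h : IsHomogeneousMetric Ω G) (hD : AgreesToOrder Ω G n)
    (i : Fin d) : Van Ω n (homothetyCurl G (idxInf d) (idxMid i)) :=
  ((h.van_curl_mid_inf hD i).neg h.isOpen).congr h.isOpen fun z _ => homothetyCurl_antisymm G _ _ z

theorem van_curl (h : IsHomogeneousMetric Ω G) (hD : AgreesToOrder Ω G n)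
    (J M : Idx d) : Van Ω n (homothetyCurl G J M) := by
  have hz : ∀ J, Van Ω n (homothetyCurl G J J) := fun J =>
    (Van.zero h.isOpen).congr h.isOpen fun z _ => homothetyCurl_self G J z
  rcases J with _ | i | _ <;> rcases M with _ | j | _
  · exact hz _
  · exact (h.van_curl_zero_mid hD j).of_succ
  · exact h.van_curl_zero_inf hD
  · exact (h.van_curl_mid_zero hD i).of_succ
  · exact (h.van_curl_mid_mid hD i j).of_succ
  · exact h.van_curl_mid_inf hD i
  · exact h.van_curl_inf_zero hD
  · exact h.van_curl_inf_mid hD j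
  · exact hz _

theorem van_defect (h : IsHomogeneousMetric Ω G) (hD : AgreesToOrder Ω G n)
    (J K : Idx d) : Van Ω n (homothetyDefect G J K) :=
  (Van.sum h.isOpen _ fun M _ => (h.van_curl hD J M).smooth_mul h.isOpen
    (h.smooth_ginv K M)).congr h.isOpen fun _ hz => h.homothetyDefect_eq J K hz

/-- The part of `F_0^K` that does not involve `F_{0∞}`. -/
theorem van_defect_zero_sub (h : IsHomogeneousMetric Ω G) (hD : AgreesToOrder Ω G n)
    (K : Idx d) : Van Ω (n + 1) (fun z => homothetyDefect G (idxZero d) K z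
    - ginv G K (idxInf d) z * homothetyCurl G (idxZero d) (idxInf d) z) := by
  refine (Van.sum h.isOpen Finset.univ fun i _ => (h.van_curl_zero_mid hD i).smooth_mul h.isOpen
    (h.smooth_ginv K (idxMid i))).congr h.isOpen fun z hz => ?_
  simp only [h.homothetyDefect_eq _ _ hz, sum_idx, homothetyCurl_self]
  ring

theorem van_defect_mid_sub (h : IsHomogeneousMetric Ω G) (hD : AgreesToOrder Ω G n)
    (i : Fin d) (K : Idx d) :
    Van Ω (n + 1) (fun z => homothetyDefect G (idxMid i) K z
      - ginv G K (idxInf d) z * homothetyCurl G (idxMid i) (idxInf d) z) := by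
  refine (((h.van_curl_mid_zero hD i).smooth_mul h.isOpen (h.smooth_ginv K (idxZero d))).add
    h.isOpen (Van.sum h.isOpen Finset.univ fun j _ => (h.van_curl_mid_mid hD i j).smooth_mul
      h.isOpen (h.smooth_ginv K (idxMid j)))).congr h.isOpen fun z hz => ?_
  simp only [h.homothetyDefect_eq _ _ hz, sum_idx]
  ring

/-- `G^{K∞} = O(ρ)` for `K ≠ 0` makes up for the order that `F_{0∞}` lacks. -/
theorem van_defect_zero_inr (h : IsHomogeneousMetric Ω G) (hD : AgreesToOrder Ω G n)
    (i : Fin d ⊕ Unit) :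
    Van Ω (n + 1) (homothetyDefect G (idxZero d) (Sum.inr i)) :=
  ((h.van_defect_zero_sub hD (Sum.inr i)).add h.isOpen ((h.van_ginv_inr_inf hD i).mul_le h.isOpen
    (h.van_curl_zero_inf hD) (add_comm n 1).le)).congr h.isOpen fun z _ => by ring

theorem van_defect_mid_inr (h : IsHomogeneousMetric Ω G) (hD : AgreesToOrder Ω G n)
    (i : Fin d) (j : Fin d ⊕ Unit) :
    Van Ω (n + 1) (homothetyDefect G (idxMid i) (Sum.inr j)) :=
  ((h.van_defect_mid_sub hD i (Sum.inr j)).add h.isOpen ((h.van_ginv_inr_inf hD j).mul_le h.isOpen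
    (h.van_curl_mid_inf hD i) (add_comm n 1).le)).congr h.isOpen fun z _ => by ring

/-- The leading part is `G^{0∞} F_{0∞}` with `G^{0∞} ≡ t⁻¹` and `F_{0∞} = -½ t u`. -/
theorem van_defect_zero_zero (h : IsHomogeneousMetric Ω G) (hD : AgreesToOrder Ω G n) :
    Van Ω (n + 1) (fun z => homothetyDefect G (idxZero d) (idxZero d) z
    + (1 / 2) * pd (idxInf d) (lapse G) z) := by
  refine ((h.van_defect_zero_sub hD (idxZero d)).add h.isOpen ((h.van_ginv_zero_inf_sub hD).mul_le
    h.isOpen (h.van_curl_zero_inf hD) (add_comm n 1).le)).congr h.isOpen fun z hz => ?_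
  have ht := (h.pos z hz).ne'
  simp only [h.homothetyCurl_zero_inf hz]
  field_simp
  ring

theorem van_defect_mid_zero (h : IsHomogeneousMetric Ω G) (hD : AgreesToOrder Ω G n)
    (i : Fin d) : Van Ω (n + 1) (fun z =>
    z.1 * homothetyDefect G (idxMid i) (idxZero d) z
      - homothetyCurl G (idxMid i) (idxInf d) z) := by
  refine (((h.van_defect_mid_sub hD i (idxZero d)).add h.isOpen
    ((h.van_ginv_zero_inf_sub hD).mul_le h.isOpen (h.van_curl_mid_inf hD i)
      (add_comm n 1).le)).smooth_mul h.isOpen smooth_fst).congr h.isOpen fun z hz => ?_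
  have ht := (h.pos z hz).ne'
  field_simp
  ring

/-- `F_{∞∞} = 0`, so only `G^{∞0} F_{∞0}` contributes to leading order. -/
theorem van_defect_inf_inf (h : IsHomogeneousMetric Ω G) (hD : AgreesToOrder Ω G n) :
    Van Ω (n + 1) (fun z => homothetyDefect G (idxInf d) (idxInf d) z
    - (1 / 2) * pd (idxInf d) (lapse G) z) := by
  refine (((h.van_ginv_inf_zero_sub hD).mul_le h.isOpen (h.van_curl_inf_zero hD)
    (add_comm n 1).le).add h.isOpen (Van.sum h.isOpen Finset.univ fun i _ =>
      (h.van_ginv_inf_mid hD i).mul_le h.isOpen (h.van_curl_inf_mid hD i)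
        (add_comm n 1).le)).congr h.isOpen fun z hz => ?_
  have ht := (h.pos z hz).ne'
  simp only [h.homothetyDefect_eq _ _ hz, sum_idx, homothetyCurl_self,
    homothetyCurl_antisymm G (idxInf d) (idxZero d), h.homothetyCurl_zero_inf hz]
  field_simp
  ring

end Order

end IsHomogeneousMetric

namespace IsHomogeneousMetric

variable {d : ℕ} {Ω : Set (Coord d)} {G : Idx d → Idx d → Coord d → ℝ}

/-! ### The `00` equation: raising the order of `G_00 = 2ρ` -/

section LapseStep

variable {n : ℕ}

theorem smooth_pd_lapse (h : IsHomogeneousMetric Ω G) :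
    ContDiffOn ℝ ∞ (pd (idxInf d) (lapse G)) Ω :=
  smooth_pd h.isOpen h.smooth_lapse _

theorem pd_zero_pd_inf_lapse (h : IsHomogeneousMetric Ω G) {z : Coord d} (hz : z ∈ Ω) :
    pd (idxZero d) (pd (idxInf d) (lapse G)) z = 0 := by
  rw [pd_comm h.isOpen h.smooth_lapse hz,
    pd_congr h.isOpen (g := fun _ => 0) (fun z hz => h.pd_zero_lapse hz) _ hz, pd_const]

theorem smooth_trace_christoffel (h : IsHomogeneousMetric Ω G) (L : Idx d) :
    ContDiffOn ℝ ∞ (fun z => ∑ K, christoffel G K K L z) Ω :=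
  ContDiffOn.sum fun K _ => h.smooth_christoffel K K L

theorem fst_mul_sum_christoffel_zero (h : IsHomogeneousMetric Ω G) {z : Coord d} (hz : z ∈ Ω) :
    z.1 * ∑ K, ∑ L, christoffel G K (idxZero d) L z * homothetyDefect G K L z =
      ∑ K, ∑ L, homothetyDefect G L K z * homothetyDefect G K L z
        - homothetyDefect G (idxZero d) (idxZero d) z := by
  have e : ∀ K, z.1 * ∑ L, christoffel G K (idxZero d) L z * homothetyDefect G K L z =
      ∑ L, homothetyDefect G L K z * homothetyDefect G K L z
        - wt K * homothetyDefect G K (idxZero d) z + homothetyDefect G K K z := by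
    intro K
    have e' : z.1 * ∑ L, christoffel G K (idxZero d) L z * homothetyDefect G K L z =
        ∑ L, (homothetyDefect G L K z * homothetyDefect G K L z
          - wt K * (wt L * homothetyDefect G K L z)
          + (1 : Matrix (Idx d) (Idx d) ℝ) K L * homothetyDefect G K L z) := by
      rw [Finset.mul_sum]
      refine Finset.sum_congr rfl fun L _ => ?_
      have h1 : (1 : Matrix (Idx d) (Idx d) ℝ) K L = (1 : Matrix (Idx d) (Idx d) ℝ) L K := by
        simp [Matrix.one_apply, eq_comm]
      rw [h1]
      linear_combination homothetyDefect G K L z * fst_mul_christoffel G L K z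
    rw [e', Finset.sum_add_distrib, Finset.sum_sub_distrib, sum_one_mul, ← Finset.mul_sum,
      sum_wt_mul (fun L => homothetyDefect G K L z)]
  rw [Finset.mul_sum, Finset.sum_congr rfl fun K _ => e K, Finset.sum_add_distrib,
    Finset.sum_sub_distrib, sum_wt_mul (fun K => homothetyDefect G K (idxZero d) z),
    h.homothetyDefect_trace hz]
  ring

/-- The leading part `-½ u` of `F_0^0` is independent of `t`. -/
theorem van_pd_zero_defect_zero_zero (h : IsHomogeneousMetric Ω G) (hD : AgreesToOrder Ω G n) :
    Van Ω (n + 1) (pd (idxZero d) (homothetyDefect G (idxZero d) (idxZero d))) := by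
  refine ((h.van_defect_zero_zero hD).pd_tangential h.isOpen (I := idxZero d) rfl).congr h.isOpen
    fun z hz => ?_
  rw [pd_add h.isOpen (h.smooth_homothetyDefect _ _) (contDiffOn_const.mul h.smooth_pd_lapse) hz,
    pd_const_mul h.isOpen _ h.smooth_pd_lapse hz, h.pd_zero_pd_inf_lapse hz]
  ring

theorem van_fst_mul_defect_zero_inf (h : IsHomogeneousMetric Ω G) (hD : AgreesToOrder Ω G n) :
    Van Ω (n + 2) (fun z =>
    z.1 * homothetyDefect G (idxZero d) (idxInf d) z
      - (1 / 2) * ((2 * z.2.2 + lapse G z) * pd (idxInf d) (lapse G) z)) := by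
  have h1 : Van Ω (n + 2) (fun z => ∑ i, ginv G (idxInf d) (idxMid i) z *
      homothetyCurl G (idxZero d) (idxMid i) z) :=
    Van.sum h.isOpen _ fun i _ => (h.van_ginv_inf_mid hD i).mul_le h.isOpen
      (h.van_curl_zero_mid hD i) (by omega)
  have h2 := (h.van_ginv_inf_inf_add hD).mul_le h.isOpen (k := n + 2) (h.van_curl_zero_inf hD)
    (by omega)
  refine ((h1.add h.isOpen h2).smooth_mul h.isOpen smooth_fst).congr h.isOpen fun z hz => ?_
  have ht := (h.pos z hz).ne'
  simp only [h.homothetyDefect_eq _ _ hz, sum_idx, homothetyCurl_self,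
    h.homothetyCurl_zero_inf hz]
  field_simp
  ring

/-- Differentiating `½ (2ρ + lapse) u` gives `u + ½ u² + ρ ∂_ρ u` plus a term `½ lapse · ∂_ρ u` of
order `n + 1`, and `ρ ∂_ρ u ≡ n u` by Euler's identity. -/
theorem van_pd_inf_defect_zero_inf (h : IsHomogeneousMetric Ω G) (hD : AgreesToOrder Ω G n) :
    Van Ω (n + 1) (fun z =>
    z.1 * pd (idxInf d) (homothetyDefect G (idxZero d) (idxInf d)) z
      - (1 + n) * pd (idxInf d) (lapse G) z - (1 / 2) * pd (idxInf d) (lapse G) z ^ 2) := by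
  have hu := h.smooth_pd_lapse
  have hl := h.smooth_lapse
  have hρ : ContDiffOn ℝ ∞ (fun z : Coord d => 2 * z.2.2) Ω := contDiffOn_const.mul smooth_rho
  have hF := h.smooth_homothetyDefect (idxZero d) (idxInf d)
  have h1 := (h.van_fst_mul_defect_zero_inf hD).pd_rho
  have h2 := (hD.lapse.pd_rho).euler h.isOpen
  have h3 := (hD.lapse.mul_smooth h.isOpen (smooth_pd h.isOpen hu (idxInf d))).const_mul h.isOpen
    (1 / 2)
  refine ((h1.add h.isOpen h2).add h.isOpen h3).congr h.isOpen fun z hz => ?_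
  rw [pd_sub h.isOpen (smooth_fst.mul hF) (contDiffOn_const.mul ((hρ.add hl).mul hu)) hz,
    pd_mul h.isOpen smooth_fst hF hz, pd_const_mul h.isOpen _ ((hρ.add hl).mul hu) hz,
    pd_mul h.isOpen (hρ.add hl) hu hz, pd_add h.isOpen hρ hl hz,
    pd_const_mul h.isOpen _ smooth_rho hz, pd_rho, pd_fst]
  simp only [stdVec]
  ring

/-- Only `F_0^0 ≡ -½ u` and `F_∞^∞ ≡ ½ u` survive; every other product has a factor of order `n +
1`. The term `½ u²` is itself of order `2n`, so it matters only for `n = 0`. -/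
theorem van_sum_defect_sq (h : IsHomogeneousMetric Ω G) (hD : AgreesToOrder Ω G n) :
    Van Ω (n + 1) (fun z =>
    ∑ K, ∑ L, homothetyDefect G L K z * homothetyDefect G K L z
      - (1 / 2) * pd (idxInf d) (lapse G) z ^ 2) := by
  have hs := h.smooth_homothetyDefect
  have hu := h.smooth_pd_lapse
  have h00 := (h.van_defect_zero_zero hD).mul_smooth h.isOpen
    ((hs (idxZero d) (idxZero d)).sub (contDiffOn_const (c := (1 / 2 : ℝ)) |>.mul hu))
  have hii := (h.van_defect_inf_inf hD).mul_smooth h.isOpen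
    ((hs (idxInf d) (idxInf d)).add (contDiffOn_const (c := (1 / 2 : ℝ)) |>.mul hu))
  have h0m := Van.sum h.isOpen Finset.univ fun i _ =>
    (h.van_defect_zero_inr hD (Sum.inl i)).mul_smooth h.isOpen (hs (idxMid i) (idxZero d))
  have h0i := (h.van_defect_zero_inr hD (Sum.inr ())).mul_smooth h.isOpen
    (hs (idxInf d) (idxZero d))
  have hmm := Van.sum h.isOpen Finset.univ fun i _ => Van.sum h.isOpen Finset.univ fun j _ =>
    (h.van_defect_mid_inr hD i (Sum.inl j)).mul_smooth h.isOpen (hs (idxMid j) (idxMid i))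
  have hmi := Van.sum h.isOpen Finset.univ fun i _ =>
    (h.van_defect_mid_inr hD i (Sum.inr ())).mul_smooth h.isOpen (hs (idxInf d) (idxMid i))
  refine (((((h00.add h.isOpen hii).add h.isOpen hmm).add h.isOpen
    (h0m.const_mul h.isOpen 2)).add h.isOpen (h0i.const_mul h.isOpen 2)).add h.isOpen
    (hmi.const_mul h.isOpen 2)).congr h.isOpen fun z hz => ?_
  simp only [sum_idx, Finset.sum_add_distrib]
  have c1 : ∑ i, homothetyDefect G (idxMid i) (idxZero d) z *
      homothetyDefect G (idxZero d) (idxMid i) z = ∑ i : Fin d,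
      homothetyDefect G (idxZero d) (idxMid i) z * homothetyDefect G (idxMid i) (idxZero d) z :=
    Finset.sum_congr rfl fun i _ => mul_comm _ _
  have c2 : ∑ i, homothetyDefect G (idxInf d) (idxMid i) z *
      homothetyDefect G (idxMid i) (idxInf d) z = ∑ i : Fin d,
      homothetyDefect G (idxMid i) (idxInf d) z * homothetyDefect G (idxInf d) (idxMid i) z :=
    Finset.sum_congr rfl fun i _ => mul_comm _ _
  have c3 : ∑ i : Fin d, ∑ j, homothetyDefect G (idxMid j) (idxMid i) z *
      homothetyDefect G (idxMid i) (idxMid j) z = ∑ i : Fin d, ∑ j : Fin d,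
      homothetyDefect G (idxMid i) (idxMid j) z * homothetyDefect G (idxMid j) (idxMid i) z :=
    Finset.sum_congr rfl fun i _ => Finset.sum_congr rfl fun j _ => mul_comm _ _
  rw [c1, c2, c3]
  ring

/-- If the Ricci component `R_00` vanishes to order `n`, then `G_00 = 2 ρ` holds to one more order,
unless `d = 2 n`. -/
theorem van_lapse_succ (h : IsHomogeneousMetric Ω G) (hD : AgreesToOrder Ω G n)
    (hn : (d : ℝ) ≠ 2 * n)
    (hR : Van Ω (n + 1) (ricci G (idxZero d) (idxZero d))) : Van Ω (n + 2) (lapse G) := by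
  have hO := h.isOpen
  have hs := h.smooth_homothetyDefect
  have tR := (hR.smooth_mul hO smooth_fst).smooth_mul hO smooth_fst
  have a := (h.van_pd_zero_defect_zero_zero hD).smooth_mul hO smooth_fst
  have b := (Van.sum hO Finset.univ fun i _ => (h.van_defect_zero_inr hD (Sum.inl i)).pd_tangential
    hO (I := idxMid i) rfl).smooth_mul hO smooth_fst
  have c := h.van_pd_inf_defect_zero_inf hD
  -- `d + 1` comes from `t Γ^K_{K0}`, the extra `1` from `fst_mul_sum_christoffel_zero`.
  have e := (h.van_defect_zero_zero hD).const_mul hO (d + 2)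
  have f := (Van.sum hO Finset.univ fun i _ => (h.van_defect_zero_inr hD (Sum.inl i)).smooth_mul hO
    (h.smooth_trace_christoffel (idxMid i))).smooth_mul hO smooth_fst
  have f' := ((h.van_defect_zero_inr hD (Sum.inr ())).smooth_mul hO
    (h.smooth_trace_christoffel (idxInf d))).smooth_mul hO smooth_fst
  have g := h.van_sum_defect_sq hD
  -- The coefficient is `(1 + n) - (d + 2)/2`; the two terms `½ u²`, from `c` and `g`, cancel.
  have key : Van Ω (n + 1) (fun z => (n - d / 2 : ℝ) * pd (idxInf d) (lapse G) z) := by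
    refine ((((((((tR.sub hO a).sub hO b).sub hO c).sub hO e).sub hO f).sub hO f').add hO
      g)).congr hO fun z hz => ?_
    have h1 := h.fst_mul_ricci (idxZero d) hz
    have h2 := h.fst_mul_sum_christoffel_zero hz
    have h3 := h.fst_mul_christoffel_trace hz
    rw [sum_idx (fun K => pd K _ z), sum_idx (fun L => _ * homothetyDefect G _ L z)] at h1
    linear_combination -z.1 * h1 + h2 - homothetyDefect G (idxZero d) (idxZero d) z * h3
  refine Van.of_pd_rho (hD.lapse.mono (by omega)) (key.of_const_mul hO ?_)
  intro h0
  apply hn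
  linarith

end LapseStep

end IsHomogeneousMetric

namespace IsHomogeneousMetric

variable {d : ℕ} {Ω : Set (Coord d)} {G : Idx d → Idx d → Coord d → ℝ}

/-! ### The `0i` equations: raising the order of `G_0i = 0` -/

section ShiftStep

variable {n : ℕ}

/-- `G_0i` has degree one in `t`, and `H_i = -½ t ∂_ρ G_0i` has one factor `t` more. -/
theorem fst_mul_pd_zero_curl_mid_inf (h : IsHomogeneousMetric Ω G)
    (i : Fin d) {z : Coord d} (hz : z ∈ Ω) :
    z.1 * pd (idxZero d) (homothetyCurl G (idxMid i) (idxInf d)) z =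
      2 * homothetyCurl G (idxMid i) (idxInf d) z := by
  have hO := h.isOpen
  have hS := h.smooth (idxZero d) (idxMid i)
  have hP := smooth_pd hO hS (idxInf d)
  have h0 := smooth_pd hO hS (idxZero d)
  have h1 : pd (idxInf d) (fun z => z.1 * pd (idxZero d) (G (idxZero d) (idxMid i)) z) z =
      pd (idxInf d) (G (idxZero d) (idxMid i)) z :=
    pd_congr hO (fun y hy => by rw [h.homogeneous _ _ y hy]; simp; norm_num) _ hz
  rw [pd_mul hO smooth_fst h0 hz, pd_fst, pd_comm hO hS hz] at h1
  rw [pd_congr hO (fun y hy => h.homothetyCurl_mid_inf i hy) _ hz, h.homothetyCurl_mid_inf i hz,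
    pd_const_mul hO _ (smooth_fst.mul hP) hz, pd_mul hO smooth_fst hP hz, pd_fst]
  simp only [stdVec] at h1 ⊢
  linear_combination -(1 / 2) * z.1 * h1

theorem van_curl_zero_inf_succ (h : IsHomogeneousMetric Ω G) (hL : Van Ω (n + 2) (lapse G)) :
    Van Ω (n + 1) (homothetyCurl G (idxZero d) (idxInf d)) :=
  ((hL.pd_rho.smooth_mul h.isOpen smooth_fst).const_mul h.isOpen _).congr h.isOpen
    fun _ hz => h.homothetyCurl_zero_inf hz

/-- The improved order of `G_00` removes the `F_{∞0}` contribution. -/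
theorem van_defect_inf_mid (h : IsHomogeneousMetric Ω G)
    (hL : Van Ω (n + 2) (lapse G)) (k : Fin d) :
    Van Ω (n + 1) (fun z =>
    homothetyDefect G (idxInf d) (idxMid k) z
      + ∑ j, ginv G (idxMid k) (idxMid j) z * homothetyCurl G (idxMid j) (idxInf d) z) := by
  refine ((h.van_curl_zero_inf_succ hL).smooth_mul h.isOpen
    (h.smooth_ginv (idxMid k) (idxZero d)).neg).congr h.isOpen fun z hz => ?_
  simp only [h.homothetyDefect_eq _ _ hz, sum_idx, homothetyCurl_self,
    homothetyCurl_antisymm G (idxInf d) _ z, mul_neg, Finset.sum_neg_distrib]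
  ring

theorem smooth_curl (h : IsHomogeneousMetric Ω G) (hD : AgreesToOrder Ω G n)
    (J M : Idx d) : ContDiffOn ℝ ∞ (homothetyCurl G J M) Ω :=
  (h.van_curl hD J M).smooth

theorem van_pd_zero_defect_mid_zero (h : IsHomogeneousMetric Ω G) (hD : AgreesToOrder Ω G n)
    (i : Fin d) : Van Ω (n + 1) (fun z =>
    z.1 * (z.1 * pd (idxZero d) (homothetyDefect G (idxMid i) (idxZero d)) z)
      - homothetyCurl G (idxMid i) (idxInf d) z) := by
  have hO := h.isOpen
  have hF := h.smooth_homothetyDefect (idxMid i) (idxZero d)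
  have hE := h.van_defect_mid_zero hD i
  refine (((hE.pd_tangential hO (I := idxZero d) rfl).smooth_mul hO smooth_fst).sub hO hE).congr hO
    fun z hz => ?_
  rw [pd_sub hO (smooth_fst.mul hF) (h.smooth_curl hD _ _) hz, pd_mul hO smooth_fst hF hz, pd_fst]
  simp only [stdVec]
  linear_combination h.fst_mul_pd_zero_curl_mid_inf i hz

/-- At `ρ = 0` only `G^{∞0} = t⁻¹` survives, and it multiplies `-∂_t G_ik = -2 t⁻¹ G_ik`, as `∂_i
G_{k0}` vanishes there. -/
theorem van_christoffel_inf_mid_mid (h : IsHomogeneousMetric Ω G) (hD : AgreesToOrder Ω G n)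
    (i k : Fin d) : Van Ω 1 (fun z =>
    z.1 * (z.1 * christoffel G (idxInf d) (idxMid i) (idxMid k) z)
      + G (idxMid i) (idxMid k) z) := by
  have hO := h.isOpen
  have hp : ∀ I J L, ContDiffOn ℝ ∞ (pd I (G J L)) Ω := fun I J L => smooth_pd hO (h.smooth J L) I
  have hsh : ∀ i j, Van Ω 1 (pd (idxMid i) (G (idxMid j) (idxZero d))) := fun i j =>
    (((hD.shift j).pd_tangential hO (I := idxMid i) rfl).mono (by omega)).congr hO
      (pd_congr hO (h.symm _ _) _)
  have h0 := ((hsh i k).add hO (hsh k i)).smooth_mul hO (h.smooth_ginv (idxInf d) (idxZero d))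
  have h0' := (h.van_ginv_inf_zero_sub hD).mul_smooth hO (hp (idxZero d) (idxMid i) (idxMid k))
  have hm := Van.sum hO Finset.univ fun j _ => (h.van_ginv_inf_mid hD j).mul_smooth hO
    (((hp (idxMid i) (idxMid k) (idxMid j)).add (hp (idxMid k) (idxMid i) (idxMid j))).sub
      (hp (idxMid j) (idxMid i) (idxMid k)))
  have hi := (h.van_ginv_inr_inf hD (Sum.inr ())).mul_smooth hO
    (((hp (idxMid i) (idxMid k) (idxInf d)).add (hp (idxMid k) (idxMid i) (idxInf d))).sub
      (hp (idxInf d) (idxMid i) (idxMid k)))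
  refine ((((((h0.sub hO h0').add hO hm).add hO hi).smooth_mul hO smooth_fst).smooth_mul hO
    smooth_fst).const_mul hO (1 / 2)).congr hO fun z hz => ?_
  have ht := (h.pos z hz).ne'
  have hh := h.homogeneous (idxMid i) (idxMid k) z hz
  simp only [wt_inr] at hh
  have hc : christoffel G (idxInf d) (idxMid i) (idxMid k) z = (1 / 2) * ∑ L,
      ginv G (idxInf d) L z * (pd (idxMid i) (G (idxMid k) L) z + pd (idxMid k) (G (idxMid i) L) z
        - pd L (G (idxMid i) (idxMid k)) z) := rfl
  rw [hc, sum_idx]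
  have hcancel : z.1 * z.1⁻¹ = 1 := mul_inv_cancel₀ ht
  linear_combination (-(1 / 2) * z.1 * pd (idxZero d) (G (idxMid i) (idxMid k)) z) * hcancel
    - (1 / 2) * hh

/-- `t Γ^j_{i0} = F_i^j + δ_i^j` with `F_i^j` of order `n + 1`, so the sum reduces to `t F_i^0 ≡
H_i`. -/
theorem van_sum_christoffel_mid_zero (h : IsHomogeneousMetric Ω G) (hD : AgreesToOrder Ω G n)
    (i : Fin d) : Van Ω (n + 1) (fun z =>
    z.1 * (z.1 * ∑ j, christoffel G (idxMid j) (idxMid i) (idxZero d) z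
      * homothetyDefect G (idxMid j) (idxZero d) z)
      - homothetyCurl G (idxMid i) (idxInf d) z) := by
  have hO := h.isOpen
  have h1 := (Van.sum hO Finset.univ fun j _ => (h.van_defect_mid_inr hD i (Sum.inl j)).mul_smooth
    hO (h.smooth_homothetyDefect (idxMid j) (idxZero d))).smooth_mul hO smooth_fst
  refine (h1.add hO (h.van_defect_mid_zero hD i)).congr hO fun z hz => ?_
  have e : z.1 * ∑ j, christoffel G (idxMid j) (idxMid i) (idxZero d) z
      * homothetyDefect G (idxMid j) (idxZero d) z =
      ∑ j, homothetyDefect G (idxMid i) (idxMid j) z * homothetyDefect G (idxMid j) (idxZero d) z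
      + homothetyDefect G (idxMid i) (idxZero d) z := by
    have e1 : ∀ j : Fin d, z.1 * (christoffel G (idxMid j) (idxMid i) (idxZero d) z
        * homothetyDefect G (idxMid j) (idxZero d) z) =
        homothetyDefect G (idxMid i) (idxMid j) z * homothetyDefect G (idxMid j) (idxZero d) z
        + if i = j then homothetyDefect G (idxMid j) (idxZero d) z else 0 := by
      intro j
      have hf := fst_mul_christoffel G (idxMid i) (idxMid j) z
      rw [← h.christoffel_symm (idxMid j) (idxMid i) _ hz, wt_inr, Matrix.one_apply] at hf
      have hif : (if i = j then homothetyDefect G (idxMid j) (idxZero d) z else 0) =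
          (if (idxMid i : Idx d) = idxMid j then 1 else 0)
            * homothetyDefect G (idxMid j) (idxZero d) z := by
        by_cases hj : i = j <;> simp [hj]
      rw [hif]
      linear_combination homothetyDefect G (idxMid j) (idxZero d) z * hf
    rw [Finset.mul_sum, Finset.sum_congr rfl fun j _ => e1 j, Finset.sum_add_distrib]
    simp
  rw [e]
  ring

theorem van_defect_zero
    (h : IsHomogeneousMetric Ω G) (hD : AgreesToOrder Ω G n) (hL : Van Ω (n + 2) (lapse G))
    (K : Idx d) : Van Ω (n + 1) (homothetyDefect G (idxZero d) K) :=
  ((h.van_defect_zero_sub hD K).add h.isOpen ((h.van_curl_zero_inf_succ hL).smooth_mul h.isOpen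
    (h.smooth_ginv K (idxInf d)))).congr h.isOpen fun z _ => by ring

theorem van_defect_inf_inf_succ
    (h : IsHomogeneousMetric Ω G) (hD : AgreesToOrder Ω G n) (hL : Van Ω (n + 2) (lapse G)) :
    Van Ω (n + 1) (homothetyDefect G (idxInf d) (idxInf d)) :=
  ((h.van_defect_inf_inf hD).add h.isOpen (hL.pd_rho.const_mul h.isOpen (1 / 2))).congr h.isOpen
    fun z _ => by ring

theorem van_sq_mul_defect_mid_inf
    (h : IsHomogeneousMetric Ω G) (hD : AgreesToOrder Ω G n) (hL : Van Ω (n + 2) (lapse G))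
    (i : Fin d) : Van Ω (n + 2) (fun z =>
    z.1 * (z.1 * homothetyDefect G (idxMid i) (idxInf d) z)
      - z.1 * homothetyCurl G (idxMid i) (idxZero d) z
      + 2 * (z.2.2 * homothetyCurl G (idxMid i) (idxInf d) z)) := by
  have hO := h.isOpen
  have h0 := (h.van_ginv_inf_zero_sub hD).mul_le hO (k := n + 2) (h.van_curl_mid_zero hD i)
    (by omega)
  have hm := Van.sum hO Finset.univ fun j _ => (h.van_ginv_inf_mid hD j).mul_le hO (k := n + 2)
    (h.van_curl_mid_mid hD i j) (by omega)
  have hi := (h.van_ginv_inf_inf_add hD).mul_le hO (k := n + 2) (h.van_curl_mid_inf hD i)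
    (by omega)
  have hl := hL.mul_smooth hO (h.smooth_curl hD (idxMid i) (idxInf d))
  refine (((((h0.add hO hm).add hO hi).smooth_mul hO smooth_fst).smooth_mul hO smooth_fst).sub hO
    hl).congr hO fun z hz => ?_
  have ht := (h.pos z hz).ne'
  simp only [h.homothetyDefect_eq _ _ hz, sum_idx]
  field_simp
  ring

/-- Here `t² F_i^∞ ≡ t F_{i0} - 2ρ H_i` and `F_{i0} ≡ -G_0i`. The ρ-derivative of the first term is
`2 H_i`, that of the second `-2 (n + 1) H_i` by Euler's identity. -/
theorem van_pd_inf_defect_mid_inf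
    (h : IsHomogeneousMetric Ω G) (hD : AgreesToOrder Ω G n) (hL : Van Ω (n + 2) (lapse G))
    (i : Fin d) : Van Ω (n + 1) (fun z =>
    z.1 * (z.1 * pd (idxInf d) (homothetyDefect G (idxMid i) (idxInf d)) z)
      + 2 * n * homothetyCurl G (idxMid i) (idxInf d) z) := by
  have hO := h.isOpen
  have hF := h.smooth_homothetyDefect (idxMid i) (idxInf d)
  have hC := h.smooth_curl hD (idxMid i) (idxZero d)
  have hH := h.smooth_curl hD (idxMid i) (idxInf d)
  have hS := h.smooth (idxZero d) (idxMid i)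
  have h1 := (h.van_sq_mul_defect_mid_inf hD hL i).pd_rho
  have h2 : Van Ω (n + 2) (fun z => homothetyCurl G (idxMid i) (idxZero d) z
      + G (idxZero d) (idxMid i) z) :=
    (((hL.pd_tangential hO (I := idxMid i) rfl).smooth_mul hO smooth_fst).const_mul hO
      (1 / 2)).congr hO fun z hz => by simp only [h.homothetyCurl_mid_zero i hz]; ring
  have h3 := h2.pd_rho.smooth_mul hO smooth_fst
  have h4 := ((h.van_curl_mid_inf hD i).euler hO).const_mul hO 2
  refine ((h1.add hO h3).sub hO h4).congr hO fun z hz => ?_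
  rw [pd_add hO ((smooth_fst.mul (smooth_fst.mul hF)).sub (smooth_fst.mul hC))
      (contDiffOn_const.mul (smooth_rho.mul hH)) hz,
    pd_sub hO (smooth_fst.mul (smooth_fst.mul hF)) (smooth_fst.mul hC) hz,
    pd_mul hO smooth_fst (smooth_fst.mul hF) hz, pd_mul hO smooth_fst hF hz,
    pd_mul hO smooth_fst hC hz, pd_const_mul hO _ (smooth_rho.mul hH) hz,
    pd_mul hO smooth_rho hH hz, pd_add hO hC hS hz, pd_fst, pd_rho]
  simp only [stdVec]
  linear_combination -2 * h.homothetyCurl_mid_inf i hz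

/-- To leading order this contracts `-G_ik` with `-G^{kj} H_j`. -/
theorem van_sum_christoffel_inf_mid
    (h : IsHomogeneousMetric Ω G) (hD : AgreesToOrder Ω G n) (hL : Van Ω (n + 2) (lapse G))
    (i : Fin d) : Van Ω (n + 1) (fun z =>
    z.1 * (z.1 * ∑ k, christoffel G (idxInf d) (idxMid i) (idxMid k) z
      * homothetyDefect G (idxInf d) (idxMid k) z)
      - homothetyCurl G (idxMid i) (idxInf d) z) := by
  have hO := h.isOpen
  have h1 := Van.sum hO Finset.univ fun k _ => (h.van_christoffel_inf_mid_mid hD i k).mul_le hO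
    (h.van_defect hD (idxInf d) (idxMid k)) (add_comm n 1).le
  have h2 := Van.sum hO Finset.univ fun k _ => (h.van_defect_inf_mid hL k).smooth_mul hO
    (h.smooth (idxMid i) (idxMid k))
  -- The middle blocks of `G` and its inverse are mutually inverse only up to `G^{j0} G_{0i} +
  -- G^{j∞} G_{∞i} = O(ρ)`.
  have h3 := Van.sum hO Finset.univ fun j _ =>
    ((((hD.shift i).mono (n := 1) (by omega)).smooth_mul hO
      (h.smooth_ginv (idxMid j) (idxZero d))).add hO
      ((h.van_ginv_inr_inf hD (Sum.inl j)).mul_smooth hO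
        (h.smooth (idxInf d) (idxMid i)))).mul_le hO (h.van_curl_mid_inf hD j) (add_comm n 1).le
  refine ((h1.sub hO h2).sub hO h3).congr hO fun z hz => ?_
  have e : homothetyCurl G (idxMid i) (idxInf d) z = ∑ j,
      (ginv G (idxMid j) (idxZero d) z * G (idxZero d) (idxMid i) z
        + ginv G (idxMid j) (idxInf d) z * G (idxInf d) (idxMid i) z)
        * homothetyCurl G (idxMid j) (idxInf d) z
      + ∑ j, ∑ k, ginv G (idxMid j) (idxMid k) z * G (idxMid k) (idxMid i) z
        * homothetyCurl G (idxMid j) (idxInf d) z := by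
    rw [← Finset.sum_add_distrib]
    have e1 : ∀ j : Fin d, (ginv G (idxMid j) (idxZero d) z * G (idxZero d) (idxMid i) z
        + ginv G (idxMid j) (idxInf d) z * G (idxInf d) (idxMid i) z)
        * homothetyCurl G (idxMid j) (idxInf d) z
        + ∑ k, ginv G (idxMid j) (idxMid k) z * G (idxMid k) (idxMid i) z
        * homothetyCurl G (idxMid j) (idxInf d) z
        = if j = i then homothetyCurl G (idxMid j) (idxInf d) z else 0 := by
      intro j
      have := h.sum_ginv_mul (idxMid j) (idxMid i) hz
      rw [sum_idx, Matrix.one_apply] at this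
      rw [← Finset.sum_mul, ← add_mul]
      have hif : (if j = i then homothetyCurl G (idxMid j) (idxInf d) z else 0) =
          (if (idxMid j : Idx d) = idxMid i then 1 else 0)
            * homothetyCurl G (idxMid j) (idxInf d) z := by
        by_cases hj : j = i <;> simp [hj]
      rw [hif, ← this]
      ring
    rw [Finset.sum_congr rfl fun j _ => e1 j]
    simp
  have e2 : ∑ j, ∑ k, ginv G (idxMid j) (idxMid k) z * G (idxMid k) (idxMid i) z
      * homothetyCurl G (idxMid j) (idxInf d) z = ∑ k, G (idxMid i) (idxMid k) z *
      ∑ j, ginv G (idxMid k) (idxMid j) z * homothetyCurl G (idxMid j) (idxInf d) z := by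
    rw [Finset.sum_comm]
    refine Finset.sum_congr rfl fun k _ => ?_
    rw [Finset.mul_sum]
    refine Finset.sum_congr rfl fun j _ => ?_
    rw [h.ginv_symm (idxMid j) _ hz, h.symm (idxMid k) _ hz]
    ring
  have e3 : ∀ k : Fin d, (z.1 * (z.1 * christoffel G (idxInf d) (idxMid i) (idxMid k) z)
      + G (idxMid i) (idxMid k) z) * homothetyDefect G (idxInf d) (idxMid k) z =
      z.1 * (z.1 * (christoffel G (idxInf d) (idxMid i) (idxMid k) z *
        homothetyDefect G (idxInf d) (idxMid k) z))
      + G (idxMid i) (idxMid k) z * homothetyDefect G (idxInf d) (idxMid k) z := fun k => by ring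
  rw [e, e2]
  simp only [e3, mul_add, Finset.sum_add_distrib, ← Finset.mul_sum]
  ring

/-- Two families survive, `Γ^j_{i0} F_j^0` and `Γ^∞_{ik} F_∞^k`, each contributing `H_i`. -/
theorem van_sum_christoffel_mid
    (h : IsHomogeneousMetric Ω G) (hD : AgreesToOrder Ω G n) (hL : Van Ω (n + 2) (lapse G))
    (i : Fin d) : Van Ω (n + 1) (fun z =>
    z.1 * (z.1 * ∑ K, ∑ L, christoffel G K (idxMid i) L z * homothetyDefect G K L z)
      - 2 * homothetyCurl G (idxMid i) (idxInf d) z) := by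
  have hO := h.isOpen
  have hc := fun K L => h.smooth_christoffel K (idxMid i) L
  have hz := Van.sum hO Finset.univ fun L _ => (h.van_defect_zero hD hL L).smooth_mul hO
    (hc (idxZero d) L)
  have hmm := Van.sum hO Finset.univ fun j _ => Van.sum hO Finset.univ fun k _ =>
    (h.van_defect_mid_inr hD j (Sum.inl k)).smooth_mul hO (hc (idxMid j) (idxMid k))
  have hmi := Van.sum hO Finset.univ fun j _ =>
    (h.van_defect_mid_inr hD j (Sum.inr ())).smooth_mul hO (hc (idxMid j) (idxInf d))
  -- `F_∞^0` is only of order `n`, but its coefficient satisfies `t Γ^∞_{i0} = F_i^∞`, of order `n +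
  -- 1`.
  have hiz := (h.van_defect_mid_inr hD i (Sum.inr ())).mul_smooth hO
    (h.smooth_homothetyDefect (idxInf d) (idxZero d))
  have hii := (h.van_defect_inf_inf_succ hD hL).smooth_mul hO (hc (idxInf d) (idxInf d))
  refine ((((((((hz.add hO hmm).add hO hmi).add hO hii).smooth_mul hO smooth_fst).add hO
    hiz).smooth_mul hO smooth_fst).add hO (h.van_sum_christoffel_mid_zero hD i)).add hO
    (h.van_sum_christoffel_inf_mid hD hL i)).congr hO fun z hz => ?_
  have hf := fst_mul_christoffel G (idxMid i) (idxInf d) z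
  rw [← h.christoffel_symm (idxInf d) (idxMid i) _ hz, wt_inr, Matrix.one_apply] at hf
  simp only [reduceCtorEq, if_false, Sum.inr.injEq] at hf
  simp only [sum_idx, Finset.sum_add_distrib]
  linear_combination z.1 * homothetyDefect G (idxInf d) (idxZero d) z * hf

/-- If `G_00 = 2 ρ` holds to order `n + 1` and the Ricci component `R_0i` vanishes to order `n`,
then `G_0i = 0` holds to one more order, unless `d = 2 n`. -/
theorem van_shift_succ
    (h : IsHomogeneousMetric Ω G) (hD : AgreesToOrder Ω G n) (hL : Van Ω (n + 2) (lapse G))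
    (hn : (d : ℝ) ≠ 2 * n) (i : Fin d)
    (hR : Van Ω (n + 1) (ricci G (idxZero d) (idxMid i))) :
    Van Ω (n + 2) (G (idxZero d) (idxMid i)) := by
  have hO := h.isOpen
  have tR := ((hR.smooth_mul hO smooth_fst).smooth_mul hO smooth_fst).smooth_mul hO smooth_fst
  have a := h.van_pd_zero_defect_mid_zero hD i
  have b := ((Van.sum hO Finset.univ fun j _ =>
    (h.van_defect_mid_inr hD i (Sum.inl j)).pd_tangential hO (I := idxMid j) rfl).smooth_mul hO
    smooth_fst).smooth_mul hO smooth_fst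
  have c := h.van_pd_inf_defect_mid_inf hD hL i
  have e := (h.van_defect_mid_zero hD i).const_mul hO (d + 1)
  have f := ((Van.sum hO Finset.univ fun j _ =>
    (h.van_defect_mid_inr hD i (Sum.inl j)).smooth_mul hO
    (h.smooth_trace_christoffel (idxMid j))).smooth_mul hO smooth_fst).smooth_mul hO smooth_fst
  have f' := (((h.van_defect_mid_inr hD i (Sum.inr ())).smooth_mul hO
    (h.smooth_trace_christoffel (idxInf d))).smooth_mul hO smooth_fst).smooth_mul hO smooth_fst
  have g := h.van_sum_christoffel_mid hD hL i
  -- The coefficient is `1 - 2n + (d + 1) - 2`, from `a`, `c`, `e` and `g`.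
  have key : Van Ω (n + 1) (fun z =>
      (d - 2 * n : ℝ) * homothetyCurl G (idxMid i) (idxInf d) z) := by
    refine ((((((((tR.sub hO a).sub hO b).sub hO c).sub hO e).sub hO f).sub hO f').add hO
      g)).congr hO fun z hz => ?_
    have h1 := h.fst_mul_ricci (idxMid i) hz
    have h3 := h.fst_mul_christoffel_trace hz
    rw [sum_idx (fun K => pd K _ z), sum_idx (fun L => _ * homothetyDefect G _ L z)] at h1
    linear_combination -z.1 ^ 2 * h1 - z.1 * homothetyDefect G (idxMid i) (idxZero d) z * h3
  have hH := key.of_const_mul hO (sub_ne_zero.2 hn)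
  refine Van.of_pd_rho ((hD.shift i).mono (by omega)) ?_
  refine ((hH.smooth_mul hO h.smooth_inv_fst).const_mul hO (-2)).congr hO fun z hz => ?_
  have ht := (h.pos z hz).ne'
  simp only [h.homothetyCurl_mid_inf i hz]
  field_simp

end ShiftStep

/-- A homogeneous metric with `G_00 = G_0i = 0` at `ρ = 0` whose Ricci components `R_{0J}` vanish to
infinite order satisfies `G_00 = 2 ρ`, `G_0i = 0` to all orders if `d` is odd and to order `d / 2`
if `d` is even. -/
theorem agreesToOrder (h : IsHomogeneousMetric Ω G) (h0 : AgreesToOrder Ω G 0)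
    (hR : ∀ (k : ℕ) (J : Idx d), Van Ω k (ricci G (idxZero d) J)) {m : ℕ}
    (hm : Odd d ∨ 2 * m ≤ d) : AgreesToOrder Ω G m := by
  induction m with
  | zero => exact h0
  | succ m ih =>
    have hD := ih (hm.imp id fun h => by omega)
    -- For even `d`, the bound `2 (m + 1) ≤ d` at the target order keeps the step strictly below the
    -- critical `m = d/2`.
    have hn : (d : ℝ) ≠ 2 * m := by
      intro he
      have he' : d = 2 * m := by exact_mod_cast he
      rcases hm with ⟨k, hk⟩ | hm <;> omega
    have hL := h.van_lapse_succ hD hn (hR _ _)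
    exact ⟨hL, fun i => h.van_shift_succ hD hL hn i (hR _ _)⟩

end IsHomogeneousMetric

theorem IsHomogeneousMetric.smooth_ricci {d : ℕ} {Ω : Set (Coord d)}
    {G : Idx d → Idx d → Coord d → ℝ} (h : IsHomogeneousMetric Ω G) (I J : Idx d) :
    ContDiffOn ℝ ∞ (ricci G I J) Ω := by
  have hc := h.smooth_christoffel
  have hp := fun L K I J => smooth_pd h.isOpen (hc K I J) L
  exact (ContDiffOn.sum fun K _ => (hp _ _ _ _).sub (hp _ _ _ _)).add
    (ContDiffOn.sum fun K _ => ContDiffOn.sum fun L _ =>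
      ((hc _ _ _).mul (hc _ _ _)).sub ((hc _ _ _).mul (hc _ _ _)))

/-- The fundamental theorem of calculus along the `ρ`-lines. -/
theorem integral_pd_rho {d : ℕ} {Ω : Set (Coord d)} (hΩ : IsOpen Ω) {f : Coord d → ℝ}
    (hf : ContDiffOn ℝ ∞ f Ω) {t ρ : ℝ} {y : Eucl d}
    (hline : ∀ s ∈ Set.uIcc 0 ρ, ((t, y, s) : Coord d) ∈ Ω) :
    ∫ s in (0 : ℝ)..ρ, pd (idxInf d) f (t, y, s) = f (t, y, ρ) - f (t, y, 0) := by
  have hcont : Continuous fun s : ℝ => ((t, y, s) : Coord d) := by fun_prop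
  refine intervalIntegral.integral_eq_sub_of_hasDerivAt (f := fun s => f (t, y, s))
    (fun s hs => ?_) ?_
  · have hl : HasDerivAt (fun s : ℝ => ((t, y, s) : Coord d)) (stdVec (idxInf d)) s :=
      (hasDerivAt_const s t).prodMk ((hasDerivAt_const s y).prodMk (hasDerivAt_id s))
    exact (differentiableAt_of_smooth hΩ hf (hline s hs)).hasFDerivAt.comp_hasDerivAt s hl
  · exact ((smooth_pd hΩ hf _).continuousOn.comp hcont.continuousOn hline).intervalIntegrable

theorem exists_basis_coord {d : ℕ} {V : Type*} [AddCommGroup V] [Module ℝ V]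
    (e : Eucl d ≃ₗ[ℝ] V) : ∃ b : Module.Basis (Idx d) ℝ (ℝ × V × ℝ), b (idxZero d) = (1, 0, 0) ∧
      (∀ i, b (idxMid i) = (0, e (EuclideanSpace.single i 1), 0)) ∧ b (idxInf d) = (0, 0, 1) := by
  let b₀ : Module.Basis (Idx d) ℝ (Coord d) := (Module.Basis.singleton Unit ℝ).prod
    ((EuclideanSpace.basisFun (Fin d) ℝ).toBasis.prod (Module.Basis.singleton Unit ℝ))
  refine ⟨b₀.map ((LinearEquiv.refl ℝ ℝ).prodCongr (e.prodCongr (LinearEquiv.refl ℝ ℝ))),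
    ?_, fun i => ?_, ?_⟩ <;> simp [b₀]

/-! ### Ambient charts and coordinate frames -/

section Frames

variable {d : ℕ} {M : Type*} [TopologicalSpace M] [ChartedSpace (Eucl d) M]

theorem isOpen_coordDomain (x₀ : M) {N : Set (ℝ × M × ℝ)} (hN : IsOpen N) :
    IsOpen (coordDomain (d := d) x₀ N) := by
  have hc : ContinuousOn (ambPoint (d := d) x₀)
      {z : Coord d | z.2.1 ∈ (extChartAt (𝓡 d) x₀).target} :=
    continuousOn_fst.prodMk (((continuousOn_extChartAt_symm x₀).comp
      (continuous_fst.comp continuous_snd).continuousOn fun _ h => h).prodMk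
        (continuous_snd.comp continuous_snd).continuousOn)
  exact hc.isOpen_inter_preimage
    ((isOpen_extChartAt_target x₀).preimage (continuous_fst.comp continuous_snd)) hN

theorem exists_ambPoint_eq {N : Set (ℝ × M × ℝ)} {z : ℝ × M × ℝ} (hz : z ∈ N) :
    ∃ (x₀ : M) (z' : Coord d), z' ∈ coordDomain x₀ N ∧ ambPoint x₀ z' = z := by
  have h : ambPoint z.2.1 (z.1, extChartAt (𝓡 d) z.2.1 z.2.1, z.2.2) = z := by
    simp [ambPoint]
  exact ⟨z.2.1, _, ⟨mem_extChartAt_target _, h.symm ▸ hz⟩, h⟩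

variable [IsManifold (𝓡 d) ∞ M]

theorem exists_coordEquiv (x₀ : M) {y : Eucl d} (hy : y ∈ (extChartAt (𝓡 d) x₀).target) :
    ∃ e : Eucl d ≃ₗ[ℝ] TangentSpace (𝓡 d) ((extChartAt (𝓡 d) x₀).symm y),
      ∀ i, e (EuclideanSpace.single i 1) = coordVec x₀ y i := by
  have h := isInvertible_mfderivWithin_extChartAt_symm (I := 𝓡 d) hy
  rw [ModelWithCorners.range_eq_univ, mfderivWithin_univ] at h
  obtain ⟨e, he⟩ := h
  exact ⟨e.toLinearEquiv, fun i => congrArg (fun l => l (EuclideanSpace.single i 1)) he⟩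

theorem exists_eq_sum_coordVec (x₀ : M) {y : Eucl d} (hy : y ∈ (extChartAt (𝓡 d) x₀).target)
    (v : TangentSpace (𝓡 d) ((extChartAt (𝓡 d) x₀).symm y)) :
    ∃ c : Fin d → ℝ, v = ∑ i, c i • coordVec x₀ y i := by
  obtain ⟨e, he⟩ := exists_coordEquiv x₀ hy
  refine ⟨fun i => e.symm v i, e.symm.injective ?_⟩
  simp only [← he, map_sum, map_smul, LinearEquiv.symm_apply_apply]
  ext j
  simp [Pi.single_apply]

theorem exists_basis_ambFrame (x₀ : M) {z : Coord d}
    (hz : z.2.1 ∈ (extChartAt (𝓡 d) x₀).target) :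
    ∃ b : Module.Basis (Idx d) ℝ (Tan (d := d) (ambPoint x₀ z)), ∀ I, b I = ambFrame x₀ z I := by
  obtain ⟨e, he⟩ := exists_coordEquiv x₀ hz
  obtain ⟨b, hb0, hbm, hbi⟩ := exists_basis_coord e
  refine ⟨b, ?_⟩
  rintro (_ | i | _)
  · exact hb0
  · exact (hbm i).trans (congrArg (fun v => (0, v, 0)) (he i))
  · exact hbi

theorem det_comp_ne_zero (x₀ : M) {G : BilinField d M} {z : Coord d}
    (hz : z.2.1 ∈ (extChartAt (𝓡 d) x₀).target) (hG : (G (ambPoint x₀ z)).Nondegenerate) :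
    (Matrix.of fun I J => comp x₀ G I J z).det ≠ 0 := by
  obtain ⟨b, hb⟩ := exists_basis_ambFrame x₀ hz
  have := (LinearMap.BilinForm.nondegenerate_iff_det_ne_zero b).1 hG
  convert this using 2
  ext I J
  simp [LinearMap.BilinForm.toMatrix_apply, hb, comp]

end Frames

/-- Lowering the index of the acceleration `Γ^K_{∞∞}` of `∂_ρ`. -/
theorem sum_christoffel_mul {d : ℕ} {Ω : Set (Coord d)}
    {G : Idx d → Idx d → Coord d → ℝ} (hs : ∀ I J, Set.EqOn (G I J) (G J I) Ω) {z : Coord d}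
    (hz : z ∈ Ω) (hdet : (Matrix.of fun I J => G I J z).det ≠ 0) (L : Idx d) :
    ∑ K, christoffel G K (idxInf d) (idxInf d) z * G K L z =
      pd (idxInf d) (G (idxInf d) L) z - (1 / 2) * pd L (G (idxInf d) (idxInf d)) z := by
  have hinv : ∀ M, ∑ K, G L K z * ginv G K M z = (1 : Matrix (Idx d) (Idx d) ℝ) L M := by
    intro M
    have := Matrix.mul_nonsing_inv (Matrix.of fun I J => G I J z) (isUnit_iff_ne_zero.2 hdet)
    simpa [Matrix.mul_apply, ginv] using congrFun (congrFun this L) M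
  have h1 : ∑ K, christoffel G K (idxInf d) (idxInf d) z * G K L z =
      ∑ M, (∑ K, G L K z * ginv G K M z) * ((1 / 2) * (pd (idxInf d) (G (idxInf d) M) z
        + pd (idxInf d) (G (idxInf d) M) z - pd M (G (idxInf d) (idxInf d)) z)) := by
    simp only [Finset.sum_mul]
    rw [Finset.sum_comm]
    refine Finset.sum_congr rfl fun K _ => ?_
    rw [hs K L hz, christoffel, Finset.mul_sum, Finset.sum_mul]
    refine Finset.sum_congr rfl fun M _ => ?_
    simp only [ginv]
    ring
  rw [h1]
  simp only [hinv]
  rw [sum_one_mul L (fun M => (1 / 2) * (pd (idxInf d) (G (idxInf d) M) z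
        + pd (idxInf d) (G (idxInf d) M) z - pd M (G (idxInf d) (idxInf d)) z))]
  ring

theorem covDeriv_rhoField {d : ℕ} (G : Idx d → Idx d → Coord d → ℝ) (K : Idx d) (z : Coord d) :
    covDeriv G rhoField rhoField K z = christoffel G K (idxInf d) (idxInf d) z := by
  have h0 : ∀ I, pd I (rhoField (d := d) K) z = 0 := fun I => pd_const _ I
  simp only [covDeriv, h0, rhoField, zero_add]
  rw [Finset.sum_eq_single (idxInf d) (fun I _ hI => by simp [hI]) (by simp)]
  rw [Finset.sum_eq_single (idxInf d) (fun I _ hI => by simp [hI]) (by simp)]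
  simp

/-! ### Components of a metric in Weyl-normal form -/

section NormalForm

variable {d p q : ℕ} {M : Type*} [TopologicalSpace M] [ChartedSpace (Eucl d) M]
  {r : WeylPair d M p q} {N : Set (ℝ × M × ℝ)} {G : BilinField d M}

theorem IsWeylPreAmbient.isSymm (hG : IsWeylPreAmbient r N G) {z : ℝ × M × ℝ} (hz : z ∈ N)
    (v w : Tan (d := d) z) : G z v w = G z w v :=
  (hG.signature z hz).1.eq v w

theorem IsWeylPreAmbient.comp_symm (hG : IsWeylPreAmbient r N G) (x₀ : M) (I J : Idx d) :
    Set.EqOn (comp x₀ G I J) (comp x₀ G J I) (coordDomain x₀ N) :=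
  fun _ hz => hG.isSymm hz.2 _ _

theorem IsWeylPreAmbient.one_mem (hG : IsWeylPreAmbient r N G) {t ρ : ℝ} {x : M}
    (h : (t, x, ρ) ∈ N) : (1, x, ρ) ∈ N := by
  have ht := hG.pos _ h
  have := hG.dilatation t⁻¹ t x ρ (inv_pos.2 ht) h
  rwa [inv_mul_cancel₀ (ne_of_gt ht)] at this

theorem scale_zero {V : Type*} [AddCommGroup V] [Module ℝ V] (s : ℝ) :
    ((s * 1, 0, 0) : ℝ × V × ℝ) = ((1 : ℝ) * s + (1 - 1)) • (1, 0, 0) := by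
  simp

theorem scale_fst {V : Type*} [AddCommGroup V] [Module ℝ V] (s : ℝ) :
    ((s, 0, 0) : ℝ × V × ℝ) = s • (1, 0, 0) := by
  simp

theorem scale_inr {V : Type*} [AddCommGroup V] [Module ℝ V] (s : ℝ) (v : V) (α : ℝ) :
    ((s * 0, v, α) : ℝ × V × ℝ) = ((0 : ℝ) * s + (1 - 0)) • (0, v, α) := by
  simp

theorem apply_sum_smul {V ι : Type*} [AddCommGroup V] [Module ℝ V] [Fintype ι]
    (B : LinearMap.BilinForm ℝ (ℝ × V × ℝ)) (u : ℝ × V × ℝ) (c : ι → ℝ) (e : ι → V) :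
    B u (0, ∑ i, c i • e i, 0) = ∑ i, c i * B u (0, e i, 0) := by
  have := map_sum (B u ∘ₗ LinearMap.inr ℝ ℝ (V × ℝ) ∘ₗ LinearMap.inl ℝ V ℝ)
    (fun i => c i • e i) Finset.univ
  simp only [map_smul, smul_eq_mul] at this
  exact this

theorem IsWeylPreAmbient.pullback_zero (hG : IsWeylPreAmbient r N G) {t : ℝ} (ht : 0 < t) (x : M)
    (w : ℝ × TangentSpace (𝓡 d) x) : G (t, x, 0) (1, 0, 0) (w.1, w.2, 0) = 0 := by
  rw [hG.pullback t x ht (1, 0) w]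
  simp [tautological]

/-- `δ_s` multiplies `∂_t` by `s` and fixes the other frame vectors; `wt I * s + (1 - wt I)` encodes
both cases. -/
theorem IsWeylPreAmbient.comp_dilatation (hG : IsWeylPreAmbient r N G) (x₀ : M) (I J : Idx d)
    {s : ℝ} (hs : 0 < s) {z : Coord d} (hz : z ∈ coordDomain x₀ N) :
    (wt I * s + (1 - wt I)) * ((wt J * s + (1 - wt J)) * comp x₀ G I J (s * z.1, z.2)) =
      s ^ 2 * comp x₀ G I J z := by
  have hfr : ∀ I : Idx d, ((s * (ambFrame x₀ z I).1, (ambFrame x₀ z I).2.1,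
      (ambFrame x₀ z I).2.2) : Tan (d := d) (ambPoint x₀ z)) =
      (wt I * s + (1 - wt I)) • ambFrame x₀ (s * z.1, z.2) I := by
    rintro (_ | i | _)
    · exact scale_zero s
    · exact scale_inr s (coordVec x₀ z.2.1 i) 0
    · exact scale_inr s 0 1
  have h1 := hG.homogeneous s z.1 _ z.2.2 hs hz.2 (ambFrame x₀ z I).1 (ambFrame x₀ z J).1
    (ambFrame x₀ z I).2.1 (ambFrame x₀ z J).2.1 (ambFrame x₀ z I).2.2 (ambFrame x₀ z J).2.2
  have h2 : G (ambPoint x₀ (s * z.1, z.2))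
      ((wt I * s + (1 - wt I)) • ambFrame x₀ (s * z.1, z.2) I)
      ((wt J * s + (1 - wt J)) • ambFrame x₀ (s * z.1, z.2) J) =
      s ^ 2 * comp x₀ G I J z := by
    rw [← hfr, ← hfr]
    exact h1
  rw [← h2, map_smul, map_smul, LinearMap.smul_apply, smul_eq_mul, smul_eq_mul, comp]
  ring

/-- Infinitesimal form of `comp_dilatation`, obtained by differentiating at `s = 1`. -/
theorem IsWeylPreAmbient.comp_homogeneous (hG : IsWeylPreAmbient r N G) (x₀ : M) (I J : Idx d)
    {z : Coord d} (hz : z ∈ coordDomain x₀ N) :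
    z.1 * pd (idxZero d) (comp x₀ G I J) z = (2 - wt I - wt J) * comp x₀ G I J z := by
  have hd := (differentiableAt_of_smooth (isOpen_coordDomain x₀ hG.isOpen)
    (hG.smooth x₀ I J) hz).hasFDerivAt
  have hl : HasDerivAt (fun s : ℝ => ((s * z.1, z.2) : Coord d)) (z.1 • stdVec (idxZero d)) 1 := by
    have := ((hasDerivAt_id (1 : ℝ)).mul_const z.1).prodMk (hasDerivAt_const (1 : ℝ) z.2)
    refine this.congr_deriv ?_
    change _ = z.1 • ((1, 0) : Coord d)
    simp
  have hφ : HasDerivAt (fun s : ℝ => comp x₀ G I J (s * z.1, z.2))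
      (z.1 * pd (idxZero d) (comp x₀ G I J) z) 1 := by
    have hz1 : ((1 * z.1, z.2) : Coord d) = z := by simp
    have := (hz1.symm ▸ hd : HasFDerivAt _ _ ((1 * z.1, z.2) : Coord d)).comp_hasDerivAt 1 hl
    exact this.congr_deriv (by rw [map_smul, hz1]; rfl)
  have hα : ∀ I : Idx d, HasDerivAt (fun s : ℝ => wt I * s + (1 - wt I)) (wt I) 1 := fun I => by
    simpa using ((hasDerivAt_id (1 : ℝ)).const_mul (wt I)).add_const (1 - wt I)
  have h1 := (hα I).mul ((hα J).mul hφ)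
  have h2 : HasDerivAt (fun s : ℝ => s ^ 2 * comp x₀ G I J z) (2 * comp x₀ G I J z) 1 := by
    simpa using (hasDerivAt_pow 2 (1 : ℝ)).mul_const (comp x₀ G I J z)
  have h3 := h1.congr_of_eventuallyEq (f₁ := fun s : ℝ => s ^ 2 * comp x₀ G I J z) (by
    filter_upwards [lt_mem_nhds (zero_lt_one (α := ℝ))] with s hs
    exact (hG.comp_dilatation x₀ I J hs hz).symm)
  have h4 := h3.unique h2
  simp at h4
  linear_combination h4

variable {A : ∀ z : ℝ × M × ℝ, Tan (d := d) z}

theorem IsWeylNormalForm.initial_inf_inf (hA : IsWeylNormalForm r N G A) {t : ℝ} (ht : 0 < t)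
    (x : M) : G (t, x, 0) (0, 0, 1) (0, 0, 1) = 0 := by
  rw [hA.initial t x ht 0 0 0 0 1 1]
  simp [tautological]

theorem IsWeylNormalForm.initial_inf_zero (hA : IsWeylNormalForm r N G A) {t : ℝ} (ht : 0 < t)
    (x : M) : G (t, x, 0) (0, 0, 1) (1, 0, 0) = t := by
  rw [hA.initial t x ht 0 1 0 0 1 0]
  simp [tautological]
  field_simp

theorem IsWeylNormalForm.initial_inf_mid (hA : IsWeylNormalForm r N G A) {t : ℝ} (ht : 0 < t)
    (x : M) (v : TangentSpace (𝓡 d) x) :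
    G (t, x, 0) (0, 0, 1) (0, v, 0) = t ^ 2 * r.a.form x v := by
  rw [hA.initial t x ht 0 0 0 v 1 0]
  simp [tautological]

theorem IsWeylNormalForm.line_mem (hA : IsWeylNormalForm r N G A) (hG : IsWeylPreAmbient r N G)
    (x₀ : M) {t ρ : ℝ} {y : Eucl d} (hz : ((t, y, ρ) : Coord d) ∈ coordDomain x₀ N) :
    ∀ s ∈ Set.uIcc 0 ρ, ((t, y, s) : Coord d) ∈ coordDomain x₀ N := by
  intro s hs
  obtain ⟨_, h2, h3⟩ := hA.interval t ((extChartAt (𝓡 d) x₀).symm y) (hG.pos _ hz.2)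
  exact ⟨hz.1, h2.uIcc_subset h3 hz.2 hs⟩

variable [IsManifold (𝓡 d) ∞ M]

/-- Turns the conditions on the acceleration into differential equations along the ρ-lines. -/
theorem IsWeylNormalForm.lower_acceleration (hA : IsWeylNormalForm r N G A)
    (hG : IsWeylPreAmbient r N G) (x₀ : M) (L : Idx d) {z : Coord d} (hz : z ∈ coordDomain x₀ N) :
    G (ambPoint x₀ z) (A (ambPoint x₀ z)) (ambFrame x₀ z L) =
      pd (idxInf d) (comp x₀ G (idxInf d) L) z
        - (1 / 2) * pd L (comp x₀ G (idxInf d) (idxInf d)) z := by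
  rw [← sum_christoffel_mul (hG.comp_symm x₀) hz
    (det_comp_ne_zero x₀ hz.1 (hG.signature _ hz.2).2.1) L, hA.acceleration x₀ z hz]
  simp only [covDeriv_rhoField, map_sum, LinearMap.sum_apply, map_smul, LinearMap.smul_apply,
    smul_eq_mul]
  rfl

/-- Orthogonality to `U` reads `½ ∂_ρ G_{∞∞} = 0`, and the initial value is zero. -/
theorem IsWeylNormalForm.comp_inf_inf (hA : IsWeylNormalForm r N G A)
    (hG : IsWeylPreAmbient r N G) (x₀ : M) :
    ∀ z ∈ coordDomain x₀ N, comp x₀ G (idxInf d) (idxInf d) z = 0 := by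
  rintro ⟨t, y, ρ⟩ hz
  have hline := hA.line_mem hG x₀ hz
  have h1 := integral_pd_rho (isOpen_coordDomain x₀ hG.isOpen)
    (hG.smooth x₀ (idxInf d) (idxInf d)) hline
  have h2 : ∀ s ∈ Set.uIcc 0 ρ, pd (idxInf d) (comp x₀ G (idxInf d) (idxInf d)) (t, y, s) = 0 := by
    intro s hs
    have h3 := hA.lower_acceleration hG x₀ (idxInf d) (hline s hs)
    have h4 := hA.orthogonal_tangent _ (hline s hs).2
    rw [hG.isSymm (hline s hs).2] at h4
    have h5 := h3.symm.trans h4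
    linarith
  rw [intervalIntegral.integral_congr h2, intervalIntegral.integral_zero] at h1
  have h3 : comp x₀ G (idxInf d) (idxInf d) (t, y, 0) = 0 :=
    hA.initial_inf_inf (hG.pos _ hz.2) _
  linarith

/-- Now that `G_{∞∞}` vanishes identically, orthogonality to `T` reads `∂_ρ G_{∞0} = 0`. -/
theorem IsWeylNormalForm.comp_zero_inf (hA : IsWeylNormalForm r N G A)
    (hG : IsWeylPreAmbient r N G) (x₀ : M) :
    ∀ z ∈ coordDomain x₀ N, comp x₀ G (idxZero d) (idxInf d) z = z.1 := by
  rintro ⟨t, y, ρ⟩ hz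
  have hO := isOpen_coordDomain (d := d) x₀ hG.isOpen
  have ht : 0 < t := hG.pos _ hz.2
  have hline := hA.line_mem hG x₀ hz
  rw [hG.comp_symm x₀ _ _ hz]
  have h1 := integral_pd_rho hO (hG.smooth x₀ (idxInf d) (idxZero d)) hline
  have h2 : ∀ s ∈ Set.uIcc 0 ρ, pd (idxInf d) (comp x₀ G (idxInf d) (idxZero d)) (t, y, s) = 0 := by
    intro s hs
    have h3 := hA.lower_acceleration hG x₀ (idxZero d) (hline s hs)
    rw [pd_congr hO (g := fun _ => 0) (hA.comp_inf_inf hG x₀) _ (hline s hs), pd_const] at h3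
    have h4 := hA.orthogonal_dilatation _ (hline s hs).2
    rw [hG.isSymm (hline s hs).2] at h4
    have h5 : (((ambPoint x₀ ((t, y, s) : Coord d)).1, 0, 0) :
        Tan (d := d) (ambPoint x₀ ((t, y, s) : Coord d))) =
        t • ambFrame x₀ ((t, y, s) : Coord d) (idxZero d) :=
      scale_fst t
    rw [h5, map_smul, h3, smul_eq_mul] at h4
    have := (mul_eq_zero.1 h4).resolve_left ht.ne'
    linarith
  rw [intervalIntegral.integral_congr h2, intervalIntegral.integral_zero] at h1
  have h3 : comp x₀ G (idxInf d) (idxZero d) (t, y, 0) = t :=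
    hA.initial_inf_zero ht _
  simp only
  linarith

/-- The integral of the acceleration along the `ρ`-lines. -/
theorem IsWeylNormalForm.integral_acceleration (hA : IsWeylNormalForm r N G A)
    (hG : IsWeylPreAmbient r N G) (x₀ : M) {t ρ : ℝ} {y : Eucl d}
    (hz : ((t, y, ρ) : Coord d) ∈ coordDomain x₀ N)
    (v : TangentSpace (𝓡 d) ((extChartAt (𝓡 d) x₀).symm y)) :
    ∫ s in (0 : ℝ)..ρ, G (t, (extChartAt (𝓡 d) x₀).symm y, s)
        (A (t, (extChartAt (𝓡 d) x₀).symm y, s)) (0, v, 0) =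
      G (t, (extChartAt (𝓡 d) x₀).symm y, ρ) (0, 0, 1) (0, v, 0)
        - t ^ 2 * r.a.form ((extChartAt (𝓡 d) x₀).symm y) v := by
  have hO := isOpen_coordDomain (d := d) x₀ hG.isOpen
  have hline := hA.line_mem hG x₀ hz
  -- The base point in `M` is fixed along a ρ-line, so the components `c` of `v` are constants of
  -- integration.
  obtain ⟨c, rfl⟩ := exists_eq_sum_coordVec x₀ hz.1 v
  have hf : ContDiffOn ℝ ∞ (fun z => ∑ i, c i * comp x₀ G (idxInf d) (idxMid i) z)
      (coordDomain x₀ N) :=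
    ContDiffOn.sum fun i _ => contDiffOn_const.mul (hG.smooth x₀ _ _)
  have h1 := integral_pd_rho hO hf hline
  have hcomp : ∀ s : ℝ, G (t, (extChartAt (𝓡 d) x₀).symm y, s) (0, 0, 1)
      (0, ∑ i, c i • coordVec x₀ y i, 0) =
      ∑ i, c i * comp x₀ G (idxInf d) (idxMid i) (t, y, s) :=
    fun s => apply_sum_smul (G (t, (extChartAt (𝓡 d) x₀).symm y, s)) _ c _
  have h0 : G (t, (extChartAt (𝓡 d) x₀).symm y, 0) (0, 0, 1)
      (0, ∑ i, c i • coordVec x₀ y i, 0) =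
      t ^ 2 * r.a.form ((extChartAt (𝓡 d) x₀).symm y) (∑ i, c i • coordVec x₀ y i) :=
    hA.initial_inf_mid (hG.pos _ hz.2) _ _
  rw [hcomp, ← h0, hcomp, ← h1]
  refine intervalIntegral.integral_congr fun s hs => ?_
  have hz' := hline s hs
  refine (apply_sum_smul (G (t, (extChartAt (𝓡 d) x₀).symm y, s)) _ c _).trans ?_
  have hpd : pd (idxInf d) (fun z => ∑ i, c i * comp x₀ G (idxInf d) (idxMid i) z) (t, y, s) =
      ∑ i, c i * pd (idxInf d) (comp x₀ G (idxInf d) (idxMid i)) (t, y, s) := by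
    simp only [pd]
    rw [fderiv_fun_sum fun i _ => (differentiableAt_of_smooth hO
      (contDiffOn_const.mul (hG.smooth x₀ _ _)) hz')]
    simp only [sum_apply]
    exact Finset.sum_congr rfl fun i _ => pd_const_mul hO (c i) (hG.smooth x₀ _ _) hz' _
  rw [hpd]
  refine Finset.sum_congr rfl fun i _ => ?_
  have h3 := hA.lower_acceleration hG x₀ (idxMid i) hz'
  rw [pd_congr hO (g := fun _ => 0) (hA.comp_inf_inf hG x₀) _ hz', pd_const] at h3
  rw [mul_zero, sub_zero] at h3
  exact congrArg (c i * ·) h3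

theorem IsWeylNormalForm.isHomogeneousMetric (hA : IsWeylNormalForm r N G A)
    (hG : IsWeylPreAmbient r N G) (x₀ : M) :
    IsHomogeneousMetric (coordDomain x₀ N) (comp x₀ G) where
  isOpen := isOpen_coordDomain x₀ hG.isOpen
  pos _ hz := hG.pos _ hz.2
  smooth := hG.smooth x₀
  symm := hG.comp_symm x₀
  det_ne_zero _ hz := det_comp_ne_zero x₀ hz.1 (hG.signature _ hz.2).2.1
  homogeneous I J _ hz := hG.comp_homogeneous x₀ I J hz
  inf_inf := hA.comp_inf_inf hG x₀
  zero_inf := hA.comp_zero_inf hG x₀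

theorem IsWeylNormalForm.agreesToOrder (hA : IsWeylNormalForm r N G A)
    (hG : IsWeylAmbient r N G) (x₀ : M) {m : ℕ} (hm : Odd d ∨ 2 * m ≤ d) :
    IsHomogeneousMetric.AgreesToOrder (coordDomain x₀ N) (comp x₀ G) m := by
  have h := hA.isHomogeneousMetric hG.toIsWeylPreAmbient x₀
  -- The base case of the induction: the tautological tensor annihilates `∂_t`.
  have hpull : ∀ (J : Idx d) (z : Coord d), z ∈ coordDomain x₀ N → z.2.2 = 0 →
      (J = idxZero d ∨ ∃ i, J = idxMid i) → comp x₀ G (idxZero d) J z = 0 := by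
    rintro J ⟨t, y, ρ⟩ hz (rfl : ρ = 0) hJ
    rcases hJ with rfl | ⟨i, rfl⟩
    · exact hG.pullback_zero (hG.pos _ hz.2) _ (1, 0)
    · exact hG.pullback_zero (hG.pos _ hz.2) _ (0, coordVec x₀ y i)
  refine h.agreesToOrder ⟨⟨h.smooth_lapse, fun z hz h0 => ?_, smooth_pd h.isOpen h.smooth_lapse _⟩,
    fun i => ⟨h.smooth _ _, fun z hz h0 => hpull _ z hz h0 (Or.inr ⟨i, rfl⟩),
      smooth_pd h.isOpen (h.smooth _ _) _⟩⟩ (fun k J => ?_) hm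
  · simp [lapse, hpull _ z hz h0 (Or.inl rfl), h0]
  · refine Van.of_iteratedFDeriv h.isOpen (h.smooth_ricci _ _) ?_
    rintro k - ⟨t, y, ρ⟩ hz (rfl : ρ = 0)
    exact hG.ricciFlat k x₀ t y (hG.pos _ hz.2) hz.1 _ J k le_rfl

end NormalForm

/-! ### The families `a_i(x, ρ)`, `g_ij(x, ρ)` and comparison with the normal form -/

section Families

variable {d p q : ℕ} {M : Type*} [TopologicalSpace M] [ChartedSpace (Eucl d) M]
  {r : WeylPair d M p q} {N : Set (ℝ × M × ℝ)} {G : BilinField d M}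

/-- The inclusion of the tangent vectors of `M` into those of `ℝ₊ × M × ℝ`. -/
def inclMid (V : Type*) [AddCommGroup V] [Module ℝ V] : V →ₗ[ℝ] ℝ × V × ℝ :=
  LinearMap.inr ℝ ℝ (V × ℝ) ∘ₗ LinearMap.inl ℝ V ℝ

/-- The family of one-forms `a_i(x, ρ) = G_{∞i}(1, x, ρ)`. -/
def familyForm (G : BilinField d M) (x : M) (ρ : ℝ) : TangentSpace (𝓡 d) x →ₗ[ℝ] ℝ :=
  G (1, x, ρ) (0, 0, 1) ∘ₗ inclMid (TangentSpace (𝓡 d) x)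

/-- The family of bilinear forms `g_ij(x, ρ) = G_ij(1, x, ρ)`. -/
def familyMetric (G : BilinField d M) (x : M) (ρ : ℝ) :
    LinearMap.BilinForm ℝ (TangentSpace (𝓡 d) x) :=
  (G (1, x, ρ)).compl₁₂ (inclMid (TangentSpace (𝓡 d) x)) (inclMid (TangentSpace (𝓡 d) x))

theorem familyForm_apply (G : BilinField d M) (x : M) (ρ : ℝ) (v : TangentSpace (𝓡 d) x) :
    familyForm G x ρ v = G (1, x, ρ) (0, 0, 1) (0, v, 0) := rfl

theorem familyMetric_apply (G : BilinField d M) (x : M) (ρ : ℝ) (v w : TangentSpace (𝓡 d) x) :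
    familyMetric G x ρ v w = G (1, x, ρ) (0, v, 0) (0, w, 0) := rfl

theorem smoothFamilies (hG : IsWeylPreAmbient r N G) :
    SmoothFamilies N (familyForm G) (familyMetric G) := by
  intro x₀
  have hi : ContDiff ℝ ∞ (fun y : Eucl d × ℝ => ((1, y.1, y.2) : Coord d)) :=
    contDiff_const.prodMk (contDiff_fst.prodMk contDiff_snd)
  have hm : ∀ I J, ContDiffOn ℝ ∞ (fun y : Eucl d × ℝ => comp x₀ G I J (1, y.1, y.2))
      {y | y.1 ∈ (extChartAt (𝓡 d) x₀).target ∧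
        ∃ t : ℝ, (t, (extChartAt (𝓡 d) x₀).symm y.1, y.2) ∈ N} := fun I J =>
    (hG.smooth x₀ I J).comp hi.contDiffOn fun y hy => ⟨hy.1, hG.one_mem hy.2.choose_spec⟩
  exact ⟨fun i => hm (idxInf d) (idxMid i), fun i j => hm (idxMid i) (idxMid j)⟩

theorem IsWeylPreAmbient.apply_mid (hG : IsWeylPreAmbient r N G) {t ρ : ℝ} {x : M}
    (hz : (t, x, ρ) ∈ N) (v w : TangentSpace (𝓡 d) x) (α β : ℝ) :
    G (t, x, ρ) (0, v, α) (0, w, β) = t ^ 2 * G (1, x, ρ) (0, v, α) (0, w, β) := by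
  have := hG.homogeneous t 1 x ρ (hG.pos _ hz) (hG.one_mem hz) 0 0 v w α β
  rwa [mul_one, mul_zero] at this

theorem weylAmbientForm_apply (a : ∀ x : M, ℝ → TangentSpace (𝓡 d) x →ₗ[ℝ] ℝ)
    (g : ∀ x : M, ℝ → LinearMap.BilinForm ℝ (TangentSpace (𝓡 d) x)) (t : ℝ) (x : M) (ρ : ℝ)
    (τ σ : ℝ) (v w : TangentSpace (𝓡 d) x) (α β : ℝ) :
    weylAmbientForm a g (t, x, ρ) (τ, v, α) (σ, w, β) = 2 * ρ * (τ * σ)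
      + t ^ 2 * (α * (t⁻¹ * σ + a x ρ w) + (t⁻¹ * τ + a x ρ v) * β) + t ^ 2 * g x ρ v w := rfl

theorem weylAmbientForm_zero (a : ∀ x : M, ℝ → TangentSpace (𝓡 d) x →ₗ[ℝ] ℝ)
    (g : ∀ x : M, ℝ → LinearMap.BilinForm ℝ (TangentSpace (𝓡 d) x)) (t : ℝ) (x : M) (ρ : ℝ)
    (σ : ℝ) (w : TangentSpace (𝓡 d) x) :
    weylAmbientForm a g (t, x, ρ) (1, 0, 0) (σ, w, 0) = 2 * ρ * σ := by
  rw [weylAmbientForm_apply, map_zero, map_zero, LinearMap.zero_apply]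
  ring

theorem mid_eq_weylAmbientForm (hG : IsWeylPreAmbient r N G) {z : ℝ × M × ℝ} (hz : z ∈ N)
    (v w : TangentSpace (𝓡 d) z.2.1) :
    G z (0, v, 0) (0, w, 0) =
      weylAmbientForm (familyForm G) (familyMetric G) z (0, v, 0) (0, w, 0) := by
  obtain ⟨t, x, ρ⟩ := z
  rw [weylAmbientForm_apply, hG.apply_mid hz, familyMetric_apply]
  ring

theorem familyMetric_isSymm (hG : IsWeylPreAmbient r N G) {t ρ : ℝ} {x : M}
    (hz : (t, x, ρ) ∈ N) : (familyMetric G x ρ).IsSymm :=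
  ⟨fun _ _ => hG.isSymm (hG.one_mem hz) _ _⟩

theorem weylAmbientForm_symm (hG : IsWeylPreAmbient r N G) {z : ℝ × M × ℝ} (hz : z ∈ N)
    (v w : Tan (d := d) z) :
    weylAmbientForm (familyForm G) (familyMetric G) z v w =
      weylAmbientForm (familyForm G) (familyMetric G) z w v := by
  obtain ⟨t, x, ρ⟩ := z
  obtain ⟨τ, v, α⟩ := v
  obtain ⟨σ, w, β⟩ := w
  rw [weylAmbientForm_apply, weylAmbientForm_apply, (familyMetric_isSymm hG hz).eq v w]
  ring

variable {A : ∀ z : ℝ × M × ℝ, Tan (d := d) z} [IsManifold (𝓡 d) ∞ M]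

/-- `G_{∞i}` is homogeneous of degree two, so `t⁻² G_{∞i}` equals its value at `t = 1`; this is the
independence of `t`. -/
theorem familyForm_eq (hG : IsWeylPreAmbient r N G) (hA : IsWeylNormalForm r N G A)
    {t ρ : ℝ} {x : M} (hz : (t, x, ρ) ∈ N) (v : TangentSpace (𝓡 d) x) :
    familyForm G x ρ v = r.a.form x v
      + (t ^ 2)⁻¹ * ∫ ρ' in (0 : ℝ)..ρ, G (t, x, ρ') (A (t, x, ρ')) (0, v, 0) := by
  obtain ⟨x₀, y, hy, rfl⟩ : ∃ x₀, ∃ y ∈ (extChartAt (𝓡 d) x₀).target,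
      (extChartAt (𝓡 d) x₀).symm y = x :=
    ⟨x, extChartAt (𝓡 d) x x, mem_extChartAt_target x, extChartAt_to_inv x⟩
  have ht : t ≠ 0 := (hG.pos _ hz).ne'
  rw [hA.integral_acceleration hG x₀ (y := y) ⟨hy, hz⟩ v, hG.apply_mid hz, familyForm_apply]
  field_simp
  ring

theorem inf_inf_eq (hG : IsWeylPreAmbient r N G) (hA : IsWeylNormalForm r N G A)
    {z : ℝ × M × ℝ} (hz : z ∈ N) : G z (0, 0, 1) (0, 0, 1) = 0 := by
  obtain ⟨x₀, z', hz', rfl⟩ := exists_ambPoint_eq (d := d) hz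
  exact hA.comp_inf_inf hG x₀ z' hz'

theorem inf_zero_eq (hG : IsWeylPreAmbient r N G) (hA : IsWeylNormalForm r N G A)
    {z : ℝ × M × ℝ} (hz : z ∈ N) : G z (0, 0, 1) (1, 0, 0) = z.1 := by
  obtain ⟨x₀, z', hz', rfl⟩ := exists_ambPoint_eq (d := d) hz
  rw [hG.isSymm hz]
  exact hA.comp_zero_inf hG x₀ z' hz'

theorem inf_eq_weylAmbientForm (hG : IsWeylPreAmbient r N G) (hA : IsWeylNormalForm r N G A)
    {z : ℝ × M × ℝ} (hz : z ∈ N) (w : Tan (d := d) z) :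
    G z (0, 0, 1) w = weylAmbientForm (familyForm G) (familyMetric G) z (0, 0, 1) w := by
  obtain ⟨t, x, ρ⟩ := z
  obtain ⟨σ, w, β⟩ := w
  have ht : t ≠ 0 := (hG.pos _ hz).ne'
  have hw : ((σ, w, β) : Tan (d := d) (t, x, ρ)) = σ • (1, 0, 0) + (0, w, 0) + β • (0, 0, 1) := by
    simp
  rw [weylAmbientForm_apply, hw, map_add, map_add, map_smul, map_smul, inf_inf_eq hG hA hz,
    inf_zero_eq hG hA hz, familyForm_apply, hG.apply_mid hz]
  simp
  field_simp

theorem van_difference (hG : IsWeylAmbient r N G) (hA : IsWeylNormalForm r N G A) (x₀ : M)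
    {m : ℕ} (hm : Odd d ∨ 2 * m ≤ d) (I J : Idx d) :
    Van (coordDomain x₀ N) (m + 1) (comp x₀ (fun z =>
      G z - weylAmbientForm (familyForm G) (familyMetric G) z) I J) := by
  have hP := hG.toIsWeylPreAmbient
  have hO := isOpen_coordDomain (d := d) x₀ hP.isOpen
  have h := hA.agreesToOrder hG x₀ hm
  have hzero : ∀ I J : Idx d, (∀ z ∈ coordDomain x₀ N, comp x₀ G I J z =
      comp x₀ (weylAmbientForm (familyForm G) (familyMetric G)) I J z) →
      Van (coordDomain x₀ N) (m + 1) (comp x₀ (fun z =>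
        G z - weylAmbientForm (familyForm G) (familyMetric G) z) I J) := fun I J hIJ =>
    (Van.zero hO).congr hO fun z hz => sub_eq_zero.2 (hIJ z hz)
  have hsymm : ∀ I J : Idx d, Set.EqOn
      (comp x₀ (fun z => G z - weylAmbientForm (familyForm G) (familyMetric G) z) J I)
      (comp x₀ (fun z => G z - weylAmbientForm (familyForm G) (familyMetric G) z) I J)
      (coordDomain x₀ N) := fun I J z hz =>
    congrArg₂ (· - ·) (hP.isSymm hz.2 _ _) (weylAmbientForm_symm hP hz.2 _ _)
  have hinf : ∀ J : Idx d, Van (coordDomain x₀ N) (m + 1) (comp x₀ (fun z =>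
      G z - weylAmbientForm (familyForm G) (familyMetric G) z) (idxInf d) J) := fun J =>
    hzero _ _ fun z hz => inf_eq_weylAmbientForm hP hA hz.2 _
  have hshift : ∀ i : Fin d, Van (coordDomain x₀ N) (m + 1) (comp x₀ (fun z =>
      G z - weylAmbientForm (familyForm G) (familyMetric G) z) (idxZero d) (idxMid i)) := fun i =>
    (h.shift i).congr hO fun z hz => by
      have : comp x₀ (weylAmbientForm (familyForm G) (familyMetric G)) (idxZero d) (idxMid i) z
          = 0 := (weylAmbientForm_zero _ _ _ _ _ _ _).trans (mul_zero _)
      exact (congrArg (comp x₀ G (idxZero d) (idxMid i) z - ·) this).trans (sub_zero _)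
  rcases I with _ | i | _ <;> rcases J with _ | j | _
  · refine h.lapse.congr hO fun z hz => ?_
    have : comp x₀ (weylAmbientForm (familyForm G) (familyMetric G)) (idxZero d) (idxZero d) z
        = 2 * z.2.2 := (weylAmbientForm_zero _ _ _ _ _ _ _).trans (mul_one _)
    exact congrArg (comp x₀ G (idxZero d) (idxZero d) z - ·) this
  · exact hshift j
  · exact (hinf _).congr hO (hsymm _ _)
  · exact (hshift i).congr hO (hsymm _ _)
  · exact hzero _ _ fun z hz => mid_eq_weylAmbientForm hP hz.2 _ _
  · exact (hinf _).congr hO (hsymm _ _)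
  · exact hinf _
  · exact hinf _
  · exact hinf _

end Families

end WeylAmbient

end

/-- Let `[g, a]` be a Weyl class on a `d`-dimensional manifold `M`, let `r = (g, a)` be any of its
representatives, and let `(N, G)` be a Weyl-ambient space in Weyl-normal form with acceleration `A`.
Then `G = 2 ρ dt² + 2 t² dρ (dt / t + a_i(x, ρ) dx^i) + t² g_ij(x, ρ) dx^i dx^j`, where
`a_i(x, ρ) = a_i(x) + t⁻² ∫₀^ρ A_i(t, x, ρ') dρ'`: the components `∞I` and `ij` agree on all of `N`,
and the remaining equations `G_00 = 2 ρ`, `G_0i = 0` hold to all orders at `ρ = 0` if `d` is odd,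
and to order `d / 2` if `d` is even. -/
theorem mainTheorem2 {d p q : ℕ} {M : Type*} [TopologicalSpace M]
    [ChartedSpace (WeylAmbient.Eucl d) M] [IsManifold (𝓡 d) ∞ M]
    (C : Set (WeylAmbient.WeylPair d M p q)) (hC : WeylAmbient.IsWeylClass C)
    (r : WeylAmbient.WeylPair d M p q) (hr : r ∈ C)
    (N : Set (ℝ × M × ℝ)) (G : WeylAmbient.BilinField d M)
    (A : ∀ z : ℝ × M × ℝ, WeylAmbient.Tan (d := d) z)
    (hG : WeylAmbient.IsWeylAmbient r N G)
    (hA : WeylAmbient.IsWeylNormalForm r N G A) :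
    ∃ (a : ∀ x : M, ℝ → TangentSpace (𝓡 d) x →ₗ[ℝ] ℝ)
      (g : ∀ x : M, ℝ → LinearMap.BilinForm ℝ (TangentSpace (𝓡 d) x)),
      WeylAmbient.SmoothFamilies N a g ∧
      (∀ (t : ℝ) (x : M) (ρ : ℝ), (t, x, ρ) ∈ N → ∀ v : TangentSpace (𝓡 d) x,
        a x ρ v = r.a.form x v
          + (t ^ 2)⁻¹ * ∫ ρ' in (0 : ℝ)..ρ, G (t, x, ρ') (A (t, x, ρ')) (0, v, 0)) ∧
      (∀ (t : ℝ) (x : M) (ρ : ℝ), (t, x, ρ) ∈ N → (g x ρ).IsSymm) ∧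
      (∀ x : M, g x 0 = r.g.form x) ∧
      (∀ z ∈ N, ∀ w : WeylAmbient.Tan (d := d) z,
        G z (0, 0, 1) w = WeylAmbient.weylAmbientForm a g z (0, 0, 1) w) ∧
      (∀ z ∈ N, ∀ v w : TangentSpace (𝓡 d) z.2.1,
        G z (0, v, 0) (0, w, 0) = WeylAmbient.weylAmbientForm a g z (0, v, 0) (0, w, 0)) ∧
      (∀ m : ℕ, (Odd d ∨ 2 * m ≤ d) →
        WeylAmbient.VanishesToOrder
          (fun x₀ : M => WeylAmbient.comp x₀
            (fun z => G z - WeylAmbient.weylAmbientForm a g z)) m) := by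
  have hP := hG.toIsWeylPreAmbient
  refine ⟨WeylAmbient.familyForm G, WeylAmbient.familyMetric G, WeylAmbient.smoothFamilies hP,
    fun t x ρ hz v => WeylAmbient.familyForm_eq hP hA hz v,
    fun t x ρ hz => WeylAmbient.familyMetric_isSymm hP hz, fun x => ?_,
    fun z hz w => WeylAmbient.inf_eq_weylAmbientForm hP hA hz w,
    fun z hz v w => WeylAmbient.mid_eq_weylAmbientForm hP hz v w, fun m hm => ?_⟩
  · ext v w
    refine (hP.pullback 1 x one_pos (0, v) (0, w)).trans ?_
    simp [WeylAmbient.tautological]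
  · intro x₀ t y ht hy I J k hk
    -- `Van` of order `m + 1` covers derivatives up to and including order `m`.
    exact ((WeylAmbient.van_difference hG hA x₀ hm I J).mono (by omega)).iteratedFDeriv_eq_zero
      (WeylAmbient.isOpen_coordDomain x₀ hP.isOpen) ⟨hy, hP.contains_zero t _ ht⟩ rfl
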